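/- All Hilbert spaces are finite dimensional and nonzero, with fixed orthonormal bases. For systems $X,Y$ let $\mathcal C(X,Y)$ be the set of quantum channels (completely positive trace preserving maps) from operators on $X$ to operators on $Y$; let $\mathfrak S(X)$ be the set of density operators on $X$, and $C_\Phi=(\Phi\otimes id)(|I_X\rangle\!\rangle\langle\!\langle I_X|)$ the Choi matrix of $\Phi$, where $|I_X\rangle\!\rangle=\sum_i|i\rangle\otimes|i\rangle$. For $\rho$ on $XY$ and a map $\phi$ from $X$ to $Y$ put $\langle\rho,\phi\rangle=\langle\!\langle I_Y|(\phi\otimes id_Y)(\rho)|I_Y\rangle\!\rangle$. Let $\|\Phi\|_\diamond=\max_{\rho\in\mathfrak S(XX)}\|(\Phi\otimes id_X)(\rho)\|_1$ be the diamond norm, and $\|\rho\|^\diamond_{Y|X}=\max\{\langle\rho,\phi\rangle:\ -\alpha\le\phi\le\alpha\text{ for some }\alpha\in\mathcal C(X,Y)\}$ its dual norm, where $\le$ is the order given by complete positivity (for $\rho\ge 0$ this is $2^{-H_{\min}(Y|X)_\rho}$). LOCC operations are taken between Alice and Bob and have finitely many rounds; Alice holds the systems with superscript $A$ and $A_0,A_1,A_0',A_1'$,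 Bob those with superscript $B$ and $B_0,B_1,B_0',B_1'$. An LOCC superchannel $\Theta$ from $\mathcal C(A_0B_0,A_1B_1)$ to $\mathcal C(R^A_0R^B_0,R^A_1R^B_1)$ consists of an arbitrary ancilla $U^AU^B$, an LOCC channel $\Theta_{\mathrm{pre}}$ from $R_0^A|R_0^B$ to $U^AA_0|B_0U^B$ and an LOCC channel $\Theta_{\mathrm{post}}$ from $U^AA_1|B_1U^B$ to $R_1^A|R_1^B$. It acts by $\Theta(\Phi)=\Theta_{\mathrm{post}}\circ(id_{U^AU^B}\otimes\Phi)\circ\Theta_{\mathrm{pre}}$, and it is also regarded as a channel from $R_0^AR_0^BA_1B_1$ to $R_1^AR_1^BA_0B_0$. Write $\|X\|^{2\text{-}LOCC}_{R^AR^B|AB}=\sup_\Theta\langle X,\Theta\rangle$, the supremum over all such $\Theta$ ($-\log$ of it is the LOCC-modified conditional min-entropy), and $\delta_{LOCC}(\Phi_1\|\Phi_2)=\inf_\Lambda\|\Lambda(\Phi_1)-\Phi_2\|_\diamond$, the infimum over all LOCC superchannels $\Lambda$ from the type of $\Phi_1$ to the type of $\Phi_2$. For a finite ensemble $\mathcal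 E=\{\lambda_i,\rho_i\}_{i=1}^n$ of states with prior probabilities let $P_{\mathrm{succ}}(\mathcal E)=\max_M\sum_i\lambda_i\mathrm{Tr}[\rho_iM_i]$ over all measurements $M$ with $n$ outcomes. For $\mathcal E$ on $R^AR^B=R^A_0R^B_0R^A_1R^B_1$ and a channel $\Phi\in\mathcal C(A_0B_0,A_1B_1)$ let $$P^{LOCC}_{\mathrm{succ}}(\mathcal E,\Phi)=\sup_{\alpha,M}\sum_i\lambda_i\mathrm{Tr}\big[\big(((id_{U^AU^B}\otimes\Phi)\circ\alpha)\otimes id_{R_1^AR_1^B}\big)(\rho_i)\,M_i\big],$$ the supremum over all ancillas $U^AU^B$, all LOCC channels $\alpha$ from $R^A_0|R^B_0$ to $U^AA_0|B_0U^B$ and all LOCC measurements $M$ with $n$ outcomes on $U^AA_1R_1^A|R_1^BB_1U^B$. **Theorem.** Let $\Phi_1\in\mathcal C(A_0B_0,A_1B_1)$, $\Phi_2\in\mathcal C(A_0'B_0',A_1'B_1')$ and $\epsilon\ge0$. The following are equivalent: (i) $\delta_{LOCC}(\Phi_1\|\Phi_2)\le\epsilon$; (ii) for any spaces $R^AR^B=R^A_0R^B_0R^A_1R^B_1$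 and any $\rho\in\mathfrak S(R^AR^B)$, $$\|\rho\otimes C_{\Phi_2}\|^{2\text{-}LOCC}_{R^AR^B|A'B'}\le\|\rho\otimes C_{\Phi_1}\|^{2\text{-}LOCC}_{R^AR^B|AB}+\frac{\epsilon}{2}\|\rho\|^\diamond_{R^A_1R^B_1|R^A_0R^B_0};$$ (iii) for any spaces $R^AR^B$ and any ensemble $\mathcal E$ on $R^AR^B$, $$P^{LOCC}_{\mathrm{succ}}(\mathcal E,\Phi_2)\le P^{LOCC}_{\mathrm{succ}}(\mathcal E,\Phi_1)+\frac{\epsilon}{2}P_{\mathrm{succ}}(\mathcal E).$$ Moreover, in (ii) and in (iii) it is enough to take $R^A_0\simeq A_0'$, $R^A_1\simeq A_1'$, $R^B_0\simeq B_0'$, $R^B_1\simeq B_1'$: each condition restricted to these spaces is still equivalent to (i). -/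

import Mathlib

/-!
Finite dimensional quantum systems are described by (finite, nonempty) index types `X`: the Hilbert
space is `ℂ^X` with its standard basis, operators are matrices indexed by `X`, and the
tensor product of the systems `X` and `Y` is the system `X × Y`.
-/

open scoped ComplexOrder Kronecker

namespace QLOCC

noncomputable section

/-! ### Operators, linear maps, channels -/

/-- Operators on the system `X`. -/
abbrev Op (X : Type) : Type := Matrix X X ℂ

/-- Linear maps from operators on `X` to operators on `Y`. -/
abbrev QMap (X Y : Type) : Type := Op X →ₗ[ℂ] Op Y

/-- Density operators. -/
def IsState {X : Type} [Fintype X] (ρ : Op X) : Prop := ρ.PosSemidef ∧ ρ.trace = 1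

/-- Renaming of the basis labels along an equivalence; used only to reorder tensor factors. -/
def relabel {X Y : Type} (e : X ≃ Y) : QMap X Y := (Matrix.reindexLinearEquiv ℂ ℂ e e).toLinearMap

/-- The map `Φ ⊗ id_Z`. -/
def ampR {X Y : Type} (Φ : QMap X Y) (Z : Type) : QMap (X × Z) (Y × Z) where
  toFun M := Matrix.of fun p q => Φ (Matrix.of fun x x' => M (x, p.2) (x', q.2)) p.1 q.1
  map_add' M N := by
    ext p q
    exact congrFun (congrFun (Φ.map_add (Matrix.of fun x x' => M (x, p.2) (x', q.2))
      (Matrix.of fun x x' => N (x, p.2) (x', q.2))) p.1) q.1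
  map_smul' c M := by
    ext p q
    exact congrFun (congrFun (Φ.map_smul c (Matrix.of fun x x' => M (x, p.2) (x', q.2))) p.1) q.1

/-- The map `id_Z ⊗ Φ`. -/
def ampL {X Y : Type} (Z : Type) (Φ : QMap X Y) : QMap (Z × X) (Z × Y) where
  toFun M := Matrix.of fun p q => Φ (Matrix.of fun x x' => M (p.1, x) (q.1, x')) p.2 q.2
  map_add' M N := by
    ext p q
    exact congrFun (congrFun (Φ.map_add (Matrix.of fun x x' => M (p.1, x) (q.1, x'))
      (Matrix.of fun x x' => N (p.1, x) (q.1, x'))) p.2) q.2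
  map_smul' c M := by
    ext p q
    exact congrFun (congrFun (Φ.map_smul c (Matrix.of fun x x' => M (p.1, x) (q.1, x'))) p.2) q.2

/-- The tensor product `Φ ⊗ Ψ` of two maps. -/
def tens {X Y X' Y' : Type} (Φ : QMap X X') (Ψ : QMap Y Y') : QMap (X × Y) (X' × Y') :=
  ampL X' Ψ ∘ₗ ampR Φ Y

/-- Complete positivity. -/
def IsCP {X Y : Type} (Φ : QMap X Y) : Prop :=
  ∀ (n : ℕ) (M : Op (X × Fin n)), M.PosSemidef → (ampR Φ (Fin n) M).PosSemidef

/-- Quantum channels: completely positive trace preserving maps. -/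
def IsChannel {X Y : Type} [Fintype X] [Fintype Y] (Φ : QMap X Y) : Prop :=
  IsCP Φ ∧ ∀ M : Op X, (Φ M).trace = M.trace

/-- Quantum instruments with outcomes in the finite set `J`. -/
def IsInstrument {X Y J : Type} [Fintype X] [Fintype Y] [Fintype J] (F : J → QMap X Y) : Prop :=
  (∀ j, IsCP (F j)) ∧ ∀ M : Op X, ∑ j, (F j M).trace = M.trace

/-- Measurements (POVMs) with outcomes in the finite set `K`. -/
def IsPOVM {X K : Type} [Fintype X] [DecidableEq X] [Fintype K] (M : K → Op X) : Prop :=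
  (∀ k, (M k).PosSemidef) ∧ ∑ k, M k = 1

/-! ### The Choi matrix, the duality, and the norms -/

/-- The (unnormalized) maximally entangled operator `|I⟩⟩⟨⟨I|` on `X × X`. -/
def maxEnt (X : Type) [DecidableEq X] : Op (X × X) :=
  Matrix.of fun p q => if p.1 = p.2 ∧ q.1 = q.2 then 1 else 0

/-- The Choi matrix `(Φ ⊗ id)(|I⟩⟩⟨⟨I|)`, an operator on (output) × (input). -/
def choi {X Y : Type} [DecidableEq X] (Φ : QMap X Y) : Op (Y × X) := ampR Φ X (maxEnt X)

/-- The duality `⟨ρ, φ⟩ = ⟨⟨I_Y| (φ ⊗ id_Y)(ρ) |I_Y⟩⟩` between operators on `X × Y` and maps from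
`X` to `Y` (a real number if `ρ` is self-adjoint and `φ` preserves self-adjointness). -/
def pairing {X Y : Type} [Fintype Y] (ρ : Op (X × Y)) (φ : QMap X Y) : ℝ :=
  (∑ i : Y, ∑ j : Y, ampR φ Y ρ (i, i) (j, j)).re

/-- The trace norm: the sum of the singular values. -/
def traceNorm {X : Type} [Fintype X] [DecidableEq X] (M : Op X) : ℝ :=
  ∑ i, √((Matrix.isHermitian_conjTranspose_mul_self M).eigenvalues i)

/-- The diamond norm `max_ρ ‖(Φ ⊗ id_X)(ρ)‖₁` over states `ρ` on `X × X`. -/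
def diamondNorm {X Y : Type} [Fintype X] [Fintype Y] [DecidableEq X] [DecidableEq Y]
    (Φ : QMap X Y) : ℝ :=
  sSup {r : ℝ | ∃ ρ : Op (X × X), IsState ρ ∧ r = traceNorm (ampR Φ X ρ)}

/-- The norm `‖ρ‖^⋄_{Y|X}` dual to the diamond norm: the maximum of `⟨ρ, φ⟩` over all `φ` with
`-α ≤ φ ≤ α` for some channel `α` from `X` to `Y`, in the order given by complete positivity. -/
def dualDiamondNorm {X Y : Type} [Fintype X] [Fintype Y] (ρ : Op (X × Y)) : ℝ :=
  sSup {r : ℝ | ∃ φ α : QMap X Y,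
    IsChannel α ∧ IsCP (α - φ) ∧ IsCP (α + φ) ∧ r = pairing ρ φ}

/-! ### LOCC -/

/-- LOCC instruments with classical outcomes in `K`, between the bipartite systems `A|B` (Alice's
factor first) and `A'|B'`, with finitely many rounds of classical communication. Either the
parties stop, declare the outcome `k` and apply local channels; or one of them applies a local
instrument, announces its outcome `j`, and they go on with an LOCC instrument that may depend
on `j`. -/
inductive IsLOCCInstrument {A' B' K : Type} [Fintype A'] [Fintype B'] [DecidableEq K] :
    ∀ {A B : Type} [Fintype A] [Fintype B], (K → QMap (A × B) (A' × B')) → Prop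
  | stop_with {A B : Type} [Fintype A] [Fintype B] (k : K) (Φ : QMap A A') (Ψ : QMap B B')
      (hΦ : IsChannel Φ) (hΨ : IsChannel Ψ) :
      IsLOCCInstrument (Pi.single k (tens Φ Ψ))
  | alice {A B C J : Type} [Fintype A] [Fintype B] [Fintype C] [Fintype J]
      (F : J → QMap A C) (hF : IsInstrument F) (E : J → K → QMap (C × B) (A' × B'))
      (hE : ∀ j, IsLOCCInstrument (E j)) :
      IsLOCCInstrument (fun k => ∑ j, E j k ∘ₗ ampR (F j) B)
  | bob {A B C J : Type} [Fintype A] [Fintype B] [Fintype C] [Fintype J]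
      (F : J → QMap B C) (hF : IsInstrument F) (E : J → K → QMap (A × C) (A' × B'))
      (hE : ∀ j, IsLOCCInstrument (E j)) :
      IsLOCCInstrument (fun k => ∑ j, E j k ∘ₗ ampL A (F j))

/-- LOCC channels from `A|B` to `A'|B'`: LOCC instruments with a single outcome. -/
def IsLOCC {A B A' B' : Type} [Fintype A] [Fintype B] [Fintype A'] [Fintype B']
    (Φ : QMap (A × B) (A' × B')) : Prop :=
  IsLOCCInstrument (fun _ : Unit => Φ)

/-- LOCC measurements on `A|B`: the measurements whose outcome distributions are those of an
LOCC instrument that discards both systems. -/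
def IsLOCCMeasurement {A B K : Type} [Fintype A] [Fintype B] [DecidableEq A] [DecidableEq B]
    [Fintype K] [DecidableEq K] (M : K → Op (A × B)) : Prop :=
  IsPOVM M ∧ ∃ E : K → QMap (A × B) (Unit × Unit), IsLOCCInstrument E ∧
    ∀ k (X : Op (A × B)), (E k X).trace = (X * M k).trace

/-- The map `id_U ⊗ Φ` for a bipartite map `Φ` and an ancilla `U = UA|UB` shared by the two
parties, with the factors grouped as Alice | Bob. -/
def withAncilla (UA UB : Type) {A₀ B₀ A₁ B₁ : Type} (Φ : QMap (A₀ × B₀) (A₁ × B₁)) :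
    QMap ((UA × A₀) × (UB × B₀)) ((UA × A₁) × (UB × B₁)) :=
  relabel (Equiv.prodProdProdComm UA UB A₁ B₁) ∘ₗ ampL (UA × UB) Φ ∘ₗ
    relabel (Equiv.prodProdProdComm UA A₀ UB B₀)

/-- LOCC superchannels from bipartite channels `A₀B₀ → A₁B₁` to bipartite channels
`S₀T₀ → S₁T₁` (Alice holds `A` and `S`, Bob holds `B` and `T`): an LOCC preprocessing and an LOCC
postprocessing connected by a bipartite ancilla `UA|UB`. -/
structure LOCCSuperchannel (A₀ B₀ A₁ B₁ S₀ T₀ S₁ T₁ : Type)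
    [Fintype A₀] [Fintype B₀] [Fintype A₁] [Fintype B₁]
    [Fintype S₀] [Fintype T₀] [Fintype S₁] [Fintype T₁] : Type 1 where
  UA : Type
  UB : Type
  [fintypeUA : Fintype UA]
  [fintypeUB : Fintype UB]
  pre : QMap (S₀ × T₀) ((UA × A₀) × (UB × B₀))
  post : QMap ((UA × A₁) × (UB × B₁)) (S₁ × T₁)
  pre_locc : IsLOCC pre
  post_locc : IsLOCC post

section Superchannels

variable {A₀ B₀ A₁ B₁ S₀ T₀ S₁ T₁ : Type}
  [Fintype A₀] [Fintype B₀] [Fintype A₁] [Fintype B₁]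
  [Fintype S₀] [Fintype T₀] [Fintype S₁] [Fintype T₁]

/-- The action of a superchannel on a map: `Λ(Φ) = Λ_post ∘ (id_U ⊗ Φ) ∘ Λ_pre`. -/
def LOCCSuperchannel.apply (Θ : LOCCSuperchannel A₀ B₀ A₁ B₁ S₀ T₀ S₁ T₁)
    (Φ : QMap (A₀ × B₀) (A₁ × B₁)) : QMap (S₀ × T₀) (S₁ × T₁) :=
  Θ.post ∘ₗ withAncilla Θ.UA Θ.UB Φ ∘ₗ Θ.pre

/-- Reordering of tensor factors that exchanges `A₀B₀` and `A₁B₁`. -/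
def exchange (UA UB A₀ B₀ A₁ B₁ : Type) :
    ((UA × A₀) × (UB × B₀)) × (A₁ × B₁) ≃ ((UA × A₁) × (UB × B₁)) × (A₀ × B₀) where
  toFun p := (((p.1.1.1, p.2.1), (p.1.2.1, p.2.2)), (p.1.1.2, p.1.2.2))
  invFun p := (((p.1.1.1, p.2.1), (p.1.2.1, p.2.2)), (p.1.1.2, p.1.2.2))
  left_inv _ := rfl
  right_inv _ := rfl

/-- The superchannel as a map from operators on `(S₀T₀)(A₁B₁)` to operators on `(S₁T₁)(A₀B₀)`:
the preprocessing acts on `S₀T₀` and outputs `U` and `A₀B₀`, and the postprocessing acts on `U` and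
the input `A₁B₁`. -/
def LOCCSuperchannel.toMap (Θ : LOCCSuperchannel A₀ B₀ A₁ B₁ S₀ T₀ S₁ T₁) :
    QMap ((S₀ × T₀) × (A₁ × B₁)) ((S₁ × T₁) × (A₀ × B₀)) :=
  ampR Θ.post (A₀ × B₀) ∘ₗ relabel (exchange Θ.UA Θ.UB A₀ B₀ A₁ B₁) ∘ₗ ampR Θ.pre (A₁ × B₁)

/-- The quantity `‖X‖^{2-LOCC}_{ST|AB} = sup_Θ ⟨X, Θ⟩` over all LOCC superchannels `Θ`; minus its
logarithm is the LOCC modification of the conditional min-entropy. -/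
def norm2LOCC (X : Op (((S₀ × T₀) × (A₁ × B₁)) × ((S₁ × T₁) × (A₀ × B₀)))) : ℝ :=
  ⨆ Θ : LOCCSuperchannel A₀ B₀ A₁ B₁ S₀ T₀ S₁ T₁, pairing X Θ.toMap

/-- The LOCC conversion distance `δ_LOCC(Φ₁‖Φ₂)`. -/
def deltaLOCC [DecidableEq S₀] [DecidableEq T₀] [DecidableEq S₁] [DecidableEq T₁]
    (Φ₁ : QMap (A₀ × B₀) (A₁ × B₁)) (Φ₂ : QMap (S₀ × T₀) (S₁ × T₁)) : ℝ :=
  ⨅ Λ : LOCCSuperchannel A₀ B₀ A₁ B₁ S₀ T₀ S₁ T₁, diamondNorm (Λ.apply Φ₁ - Φ₂)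

end Superchannels

/-- The operator `ρ ⊗ C`, for `ρ` on `R₀R₁` and a Choi matrix `C` on (output) × (input), with its
tensor factors reordered as (`R₀` × output) × (`R₁` × input). -/
def tensorChoi {R₀ R₁ X₁ X₀ : Type} (ρ : Op (R₀ × R₁)) (C : Op (X₁ × X₀)) :
    Op ((R₀ × X₁) × (R₁ × X₀)) :=
  relabel (Equiv.prodProdProdComm R₀ R₁ X₁ X₀) (ρ ⊗ₖ C)

/-! ### Ensembles and guessing games -/

/-- Ensembles of `n` states on `X` with prior probabilities. -/
structure Ensemble (X : Type) [Fintype X] (n : ℕ) where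
  prob : Fin n → ℝ
  state : Fin n → Op X
  prob_nonneg : ∀ i, 0 ≤ prob i
  prob_sum : ∑ i, prob i = 1
  state_isState : ∀ i, IsState (state i)

/-- The optimal success probability in guessing a state of the ensemble. -/
def Ensemble.psucc {X : Type} [Fintype X] [DecidableEq X] {n : ℕ} (𝓔 : Ensemble X n) : ℝ :=
  sSup {r : ℝ | ∃ M : Fin n → Op X, IsPOVM M ∧
    r = ∑ i, 𝓔.prob i * ((𝓔.state i * M i).trace).re}

/-- Strategies in the guessing game with the channel `A₀B₀ → A₁B₁` and an ensemble of `n` states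
on `(S₀T₀)(S₁T₁)`: an LOCC preprocessing `S₀|T₀ → UA A₀|UB B₀` and an LOCC measurement
on `UA A₁ S₁|UB B₁ T₁`, where the bipartite ancilla `UA|UB` can be chosen freely. -/
structure LOCCStrategy (A₀ B₀ A₁ B₁ S₀ T₀ S₁ T₁ : Type)
    [Fintype A₀] [Fintype B₀] [Fintype A₁] [Fintype B₁]
    [Fintype S₀] [Fintype T₀] [Fintype S₁] [Fintype T₁]
    [DecidableEq A₁] [DecidableEq B₁] [DecidableEq S₁] [DecidableEq T₁] (n : ℕ) : Type 1 where
  UA : Type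
  UB : Type
  [fintypeUA : Fintype UA]
  [fintypeUB : Fintype UB]
  [decidableEqUA : DecidableEq UA]
  [decidableEqUB : DecidableEq UB]
  pre : QMap (S₀ × T₀) ((UA × A₀) × (UB × B₀))
  meas : Fin n → Op (((UA × A₁) × S₁) × ((UB × B₁) × T₁))
  pre_locc : IsLOCC pre
  meas_locc : IsLOCCMeasurement meas

section Games

variable {A₀ B₀ A₁ B₁ S₀ T₀ S₁ T₁ : Type}
  [Fintype A₀] [Fintype B₀] [Fintype A₁] [Fintype B₁]
  [Fintype S₀] [Fintype T₀] [Fintype S₁] [Fintype T₁]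
  [DecidableEq A₁] [DecidableEq B₁] [DecidableEq S₁] [DecidableEq T₁]

/-- The state that is measured: the preprocessing and then the channel `Φ` are applied to the
part `S₀T₀` of `ρ`, and the factors are grouped as Alice | Bob. -/
def LOCCStrategy.output {n : ℕ} (σ : LOCCStrategy A₀ B₀ A₁ B₁ S₀ T₀ S₁ T₁ n)
    (Φ : QMap (A₀ × B₀) (A₁ × B₁)) (ρ : Op ((S₀ × T₀) × (S₁ × T₁))) :
    Op (((σ.UA × A₁) × S₁) × ((σ.UB × B₁) × T₁)) :=
  relabel (Equiv.prodProdProdComm (σ.UA × A₁) (σ.UB × B₁) S₁ T₁)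
    (ampR (withAncilla σ.UA σ.UB Φ ∘ₗ σ.pre) (S₁ × T₁) ρ)

/-- The success probability of a strategy. -/
def LOCCStrategy.value {n : ℕ} (σ : LOCCStrategy A₀ B₀ A₁ B₁ S₀ T₀ S₁ T₁ n)
    (Φ : QMap (A₀ × B₀) (A₁ × B₁)) (𝓔 : Ensemble ((S₀ × T₀) × (S₁ × T₁)) n) : ℝ :=
  letI := σ.fintypeUA
  letI := σ.fintypeUB
  ∑ i, 𝓔.prob i * ((σ.output Φ (𝓔.state i) * σ.meas i).trace).re

/-- The optimal success probability with the channel `Φ`, LOCC preprocessings and LOCC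
measurements. -/
def psuccLOCC {n : ℕ} (Φ : QMap (A₀ × B₀) (A₁ × B₁))
    (𝓔 : Ensemble ((S₀ × T₀) × (S₁ × T₁)) n) : ℝ :=
  ⨆ σ : LOCCStrategy A₀ B₀ A₁ B₁ S₀ T₀ S₁ T₁ n, σ.value Φ 𝓔

end Games

end

end QLOCC

open QLOCC

/-! Conversion of bipartite channels by LOCC superchannels. -/

set_option linter.unusedSectionVars false

namespace QLOCC

noncomputable section

open Matrix

/-! ### Positive semidefinite matrices -/

theorem trace_vecMulVec_mul {X : Type} [Fintype X] (v w : X → ℂ) (B : Op X) :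
    (vecMulVec v w * B).trace = w ⬝ᵥ (B *ᵥ v) := by
  rw [vecMulVec_mul, trace_vecMulVec, dotProduct_comm, dotProduct_mulVec]

theorem trace_mul_nonneg {X : Type} [Fintype X] {A B : Op X} (hA : A.PosSemidef)
    (hB : B.PosSemidef) : 0 ≤ (A * B).trace := by
  obtain ⟨m, v, rfl⟩ := posSemidef_iff_eq_sum_vecMulVec.mp hA
  rw [Finset.sum_mul, trace_sum]
  refine Finset.sum_nonneg fun i _ => ?_
  rw [trace_vecMulVec_mul]
  exact hB.dotProduct_mulVec_nonneg _

theorem posSemidef_of_trace_mul_nonneg {X : Type} [Fintype X] {M : Op X}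
    (h : ∀ P : Op X, P.PosSemidef → 0 ≤ (P * M).trace) : M.PosSemidef := by
  classical
  rw [← isPositive_toEuclideanLin_iff, LinearMap.isPositive_iff_complex]
  intro x
  have h1 := h _ (posSemidef_vecMulVec_self_star (x.ofLp))
  rw [trace_vecMulVec_mul] at h1
  have h2 : inner ℂ (M.toEuclideanLin x) x = star (star x.ofLp ⬝ᵥ (M *ᵥ x.ofLp)) := by
    rw [EuclideanSpace.inner_eq_star_dotProduct]
    rw [← star_dotProduct_star, star_star]
    simp [dotProduct_comm]
  rw [h2]
  rw [Complex.nonneg_iff] at h1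
  refine ⟨Complex.ext ?_ ?_, ?_⟩ <;> simp [h1.1, ← h1.2]

theorem exists_trace_mul_eq {X : Type} [Fintype X] (L : Op X →ₗ[ℂ] ℂ) :
    ∃ M : Op X, ∀ A, L A = (A * M).trace := by
  classical
  refine ⟨of fun i j => L (single j i 1), fun A => ?_⟩
  conv_lhs => rw [matrix_eq_sum_single A]
  simp only [map_sum, trace, diag_apply, mul_apply, of_apply]
  refine Finset.sum_congr rfl fun i _ => Finset.sum_congr rfl fun j _ => ?_
  have h : single i j (A i j) = A i j • single i j (1 : ℂ) := by simp
  rw [h, map_smul, smul_eq_mul]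

theorem trace_re_smul {X : Type} [Fintype X] (c : ℝ) (A : Op X) :
    ((c • A).trace).re = c * A.trace.re := by
  simp [trace_smul]

open scoped MatrixOrder Matrix.Norms.L2Operator in
theorem exists_isOpen_le_smul_one {X : Type} [Fintype X] [DecidableEq X] {δ : ℝ} (hδ : 0 < δ) :
    ∃ U : Set (Op X), IsOpen U ∧ 0 ∈ U ∧
      ∀ M ∈ U, (δ • (1 : Op X) - (M + Mᴴ)).PosSemidef := by
  refine ⟨Metric.ball 0 (δ / 2), Metric.isOpen_ball, by simpa using hδ, fun M hM => ?_⟩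
  have h1 : IsSelfAdjoint (M + Mᴴ) := IsSelfAdjoint.add_star_self M
  have h2 := h1.le_algebraMap_norm_self
  have h3 : ‖M + Mᴴ‖ ≤ δ := by
    have := norm_add_le M Mᴴ
    have h4 : ‖Mᴴ‖ = ‖M‖ := norm_star M
    have h5 : ‖M‖ < δ / 2 := by simpa using hM
    linarith
  have h6 : algebraMap ℝ (Op X) ‖M + Mᴴ‖ ≤ algebraMap ℝ (Op X) δ := algebraMap_mono _ h3
  have := h2.trans h6
  rwa [Algebra.algebraMap_eq_smul_one, le_iff] at this

/-- Separation of a Hermitian matrix from the lower closure of a convex set of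
Hermitian matrices by a density matrix. -/
theorem exists_state_of_forall_not_le {X : Type} [Fintype X] {K : Set (Op X)}
    (hK : Convex ℝ K) (hne : K.Nonempty) {W : Op X}
    (hKH : ∀ k ∈ K, k.IsHermitian) (hW : ∀ k ∈ K, ¬ (k - W).PosSemidef) (hWH : W.IsHermitian) :
    ∃ ρ : Op X, IsState ρ ∧ ∀ k ∈ K, ((k * ρ).trace).re ≤ ((W * ρ).trace).re := by
  classical
  let S : Set (Op X) := {M | ∃ k ∈ K, ∃ δ : ℝ, 0 < δ ∧
    ((2 : ℝ) • k - (M + Mᴴ) - δ • (1 : Op X)).PosSemidef}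
  have hSo : IsOpen S := by
    rw [isOpen_iff_forall_mem_open]
    rintro M ⟨k, hk, δ, hδ, hM⟩
    obtain ⟨U, hU, h0, hUM⟩ := exists_isOpen_le_smul_one (X := X) (half_pos hδ)
    refine ⟨(fun N => N - M) ⁻¹' U, fun N hN => ⟨k, hk, δ / 2, half_pos hδ, ?_⟩,
      hU.preimage (by fun_prop), by simpa using h0⟩
    have hN' : N - M ∈ U := hN
    convert hM.add (hUM _ hN') using 1
    have : δ • (1 : Op X) = (δ / 2) • (1 : Op X) + (δ / 2) • (1 : Op X) := by
      rw [← add_smul, add_halves]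
    rw [this, conjTranspose_sub]
    abel
  have hSc : Convex ℝ S := by
    rintro M ⟨k, hk, δ, hδ, hM⟩ N ⟨l, hl, γ, hγ, hN⟩ a b ha hb hab
    refine ⟨a • k + b • l, hK hk hl ha hb hab, a * δ + b * γ, ?_, ?_⟩
    · rcases ha.eq_or_lt with rfl | ha'
      · have : b = 1 := by linarith
        subst this; linarith
      · have := mul_pos ha' hδ
        have := mul_nonneg hb hγ.le
        linarith
    · have h1 := (hM.smul ha).add (hN.smul hb)
      convert h1 using 1
      simp only [smul_sub, smul_add, conjTranspose_add, conjTranspose_smul, star_trivial, add_smul,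
        smul_smul, mul_comm (2 : ℝ)]
      abel
  have hWS : W ∉ S := by
    rintro ⟨k, hk, δ, hδ, hM⟩
    refine hW k hk ?_
    have h1 := (hM.add (PosSemidef.one.smul hδ.le)).smul (a := (1 / 2 : ℝ)) (by norm_num)
    convert h1 using 1
    rw [hWH.eq, sub_add_cancel, ← two_smul ℝ W, ← smul_sub, smul_smul]
    norm_num
  obtain ⟨f, hf⟩ := RCLike.geometric_hahn_banach_open_point (𝕜 := ℂ) hSc hSo hWS
  obtain ⟨ρ, hρ⟩ := exists_trace_mul_eq (f : Op X →ₗ[ℂ] ℂ)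
  have hρ' : ∀ A, f A = (A * ρ).trace := hρ
  obtain ⟨k₀, hk₀⟩ := hne
  have hdelta : ∀ k ∈ K, ∀ t : ℝ, 0 < t → ∀ P A : Op X, P.PosSemidef → Aᴴ = -A →
      ((k * ρ).trace).re - t * (ρ.trace).re - ((P * ρ).trace).re + ((A * ρ).trace).re
        < ((W * ρ).trace).re := by
    intro k hk t ht P A hP hA
    have hmem : k - t • (1 : Op X) - P + A ∈ S := by
      refine ⟨k, hk, 2 * t, by positivity, ?_⟩
      convert hP.smul (a := (2 : ℝ)) (by norm_num) using 1
      simp only [conjTranspose_add, conjTranspose_sub, conjTranspose_smul, (hKH k hk).eq, hP.1.eq, hA,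
        star_trivial, conjTranspose_one, two_smul, two_mul, add_smul]
      abel
    have h1 := hf _ hmem
    rw [hρ', hρ'] at h1
    simpa [add_mul, sub_mul, trace_add, trace_sub, trace_smul] using h1
  have hskew : ∀ A : Op X, Aᴴ = -A → ((A * ρ).trace).re = 0 := by
    intro A hA
    by_contra hne
    set c := ((A * ρ).trace).re with hc
    set d := ((W * ρ).trace).re - ((k₀ * ρ).trace).re + (ρ.trace).re with hd
    have h1 := hdelta k₀ hk₀ 1 one_pos 0 ((d / c) • A) PosSemidef.zero (by simp [hA])
    simp only [smul_mul_assoc, trace_re_smul, ← hc, zero_mul, trace_zero, Complex.zero_re] at h1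
    rw [div_mul_cancel₀ _ hne] at h1
    linarith
  have hpos : ∀ P : Op X, P.PosSemidef → 0 ≤ ((P * ρ).trace).re := by
    intro P hP
    by_contra! hneg
    set c := ((P * ρ).trace).re with hc
    set d := ((W * ρ).trace).re - ((k₀ * ρ).trace).re + (ρ.trace).re with hd
    have h1 := hdelta k₀ hk₀ 1 one_pos ((|d| / -c) • P) 0
      (hP.smul (div_nonneg (abs_nonneg _) (by linarith))) (by simp)
    simp only [smul_mul_assoc, trace_re_smul, ← hc, zero_mul, trace_zero, Complex.zero_re] at h1
    have h2 : |d| / -c * c = -|d| := by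
      rw [div_neg, neg_mul, div_mul_cancel₀ _ hneg.ne]
    rw [h2] at h1
    linarith [le_abs_self d]
  have hρP : ρ.PosSemidef := by
    refine posSemidef_of_trace_mul_nonneg fun P hP => ?_
    rw [Complex.nonneg_iff]
    refine ⟨hpos P hP, ?_⟩
    have h1 := hskew (Complex.I • P) (by rw [conjTranspose_smul, hP.1.eq]; simp)
    simp only [smul_mul_assoc, trace_smul, smul_eq_mul, Complex.mul_re, Complex.I_re,
      Complex.I_im, zero_mul, one_mul, zero_sub, neg_eq_zero] at h1
    exact h1.symm
  have hρ0 : 0 < (ρ.trace).re := by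
    have h0 : 0 ≤ ρ.trace := hρP.trace_nonneg
    rw [Complex.nonneg_iff] at h0
    refine h0.1.lt_of_ne fun h => ?_
    have h2 : ρ.trace = 0 := Complex.ext h.symm h0.2.symm
    rw [hρP.trace_eq_zero_iff] at h2
    have h3 := hdelta k₀ hk₀ 1 one_pos 0 0 PosSemidef.zero (by simp)
    simp [h2] at h3
  have hle : ∀ k ∈ K, ((k * ρ).trace).re ≤ ((W * ρ).trace).re := by
    intro k hk
    refine le_of_forall_pos_lt_add fun ε hε => ?_
    have h1 := hdelta k hk (ε / (ρ.trace).re) (div_pos hε hρ0) 0 0 PosSemidef.zero (by simp)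
    simp only [zero_mul, trace_zero, Complex.zero_re] at h1
    rw [div_mul_cancel₀ _ hρ0.ne'] at h1
    linarith
  refine ⟨(ρ.trace).re⁻¹ • ρ, ⟨hρP.smul (inv_nonneg.mpr hρ0.le), ?_⟩, fun k hk => ?_⟩
  · have h0 : 0 ≤ ρ.trace := hρP.trace_nonneg
    rw [Complex.nonneg_iff] at h0
    have h2 : ρ.trace = ((ρ.trace).re : ℂ) := Complex.ext (by simp) (by simpa using h0.2.symm)
    rw [trace_smul]
    conv_lhs => rw [h2]
    rw [Complex.real_smul, ← Complex.ofReal_mul]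
    simp [hρ0.ne']
  · simp only [mul_smul_comm, trace_re_smul]
    exact mul_le_mul_of_nonneg_left (hle k hk) (inv_nonneg.mpr hρ0.le)

/-- The matrix obtained by applying `f` to the eigenvalues of a Hermitian matrix. -/
def spectralMap {X : Type} [Fintype X] [DecidableEq X] {H : Op X} (hH : H.IsHermitian)
    (f : ℝ → ℝ) : Op X :=
  (hH.eigenvectorUnitary : Op X) * diagonal (fun i => (f (hH.eigenvalues i) : ℂ)) *
    (hH.eigenvectorUnitary : Op X)ᴴ

section spectralMap

variable {X : Type} [Fintype X] [DecidableEq X] {H : Op X} (hH : H.IsHermitian)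

theorem spectralMap_posSemidef' {f : ℝ → ℝ} (hf : ∀ i, 0 ≤ f (hH.eigenvalues i)) :
    (spectralMap hH f).PosSemidef := by
  refine PosSemidef.mul_mul_conjTranspose_same (PosSemidef.diagonal fun i => ?_) _
  simpa using hf _

theorem spectralMap_posSemidef {f : ℝ → ℝ} (hf : ∀ x, 0 ≤ f x) :
    (spectralMap hH f).PosSemidef :=
  spectralMap_posSemidef' hH fun _ => hf _

theorem spectralMap_mul (f g : ℝ → ℝ) :
    spectralMap hH f * spectralMap hH g = spectralMap hH (fun x => f x * g x) := by
  have h : (hH.eigenvectorUnitary : Op X)ᴴ * (hH.eigenvectorUnitary : Op X) = 1 :=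
    Unitary.coe_star_mul_self _
  unfold spectralMap
  rw [← mul_assoc, ← mul_assoc, mul_assoc _ (_ᴴ) (hH.eigenvectorUnitary : Op X), h, mul_one,
    mul_assoc (hH.eigenvectorUnitary : Op X), diagonal_mul_diagonal]
  simp

theorem spectralMap_sub (f g : ℝ → ℝ) :
    spectralMap hH (fun x => f x - g x) = spectralMap hH f - spectralMap hH g := by
  unfold spectralMap
  rw [← sub_mul, ← mul_sub, diagonal_sub]
  simp

theorem spectralMap_id : spectralMap hH (fun x => x) = H := by
  conv_rhs => rw [hH.spectral_theorem, Unitary.conjStarAlgAut_apply]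
  rfl

theorem spectralMap_const (c : ℝ) : spectralMap hH (fun _ => c) = (c : ℂ) • 1 := by
  have h : (hH.eigenvectorUnitary : Op X) * (hH.eigenvectorUnitary : Op X)ᴴ = 1 :=
    Unitary.coe_mul_star_self _
  rw [spectralMap, ← smul_one_eq_diagonal, mul_smul_comm, smul_mul_assoc, mul_one, h]

theorem spectralMap_one : spectralMap hH (fun _ => 1) = 1 := by
  rw [spectralMap_const, Complex.ofReal_one, one_smul]

theorem trace_spectralMap (f : ℝ → ℝ) :
    (spectralMap hH f).trace = ((∑ i, f (hH.eigenvalues i) : ℝ) : ℂ) := by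
  have h : (hH.eigenvectorUnitary : Op X)ᴴ * (hH.eigenvectorUnitary : Op X) = 1 :=
    Unitary.coe_star_mul_self _
  rw [spectralMap, trace_mul_cycle, h, one_mul, trace_diagonal]
  simp

theorem charpoly_spectralMap (f : ℝ → ℝ) :
    (spectralMap hH f).charpoly =
      ∏ i, (Polynomial.X - Polynomial.C (f (hH.eigenvalues i) : ℂ)) := by
  have h : (hH.eigenvectorUnitary : Op X)ᴴ * (hH.eigenvectorUnitary : Op X) = 1 :=
    Unitary.coe_star_mul_self _
  rw [spectralMap, charpoly_mul_comm, ← mul_assoc, h, one_mul, charpoly_diagonal]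

theorem traceNorm_eq_sum_abs : traceNorm H = ∑ i, |hH.eigenvalues i| := by
  have h1 : Hᴴ * H = spectralMap hH (fun x => x * x) := by
    rw [hH.eq, ← spectralMap_mul, spectralMap_id]
  have h2 := (isHermitian_conjTranspose_mul_self H).roots_charpoly_eq_eigenvalues
  conv_lhs at h2 => rw [h1]
  rw [charpoly_spectralMap, Polynomial.roots_prod _ _ (by
    exact Finset.prod_ne_zero_iff.mpr fun i _ => Polynomial.X_sub_C_ne_zero _)] at h2
  simp only [Polynomial.roots_X_sub_C, Multiset.bind_singleton] at h2
  have h3 := congrArg (fun s => (s.map fun z : ℂ => √z.re).sum) h2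
  simp only [Multiset.map_map, Function.comp_def] at h3
  unfold traceNorm
  refine Eq.trans ?_ (h3.symm.trans ?_)
  · simp
  · simp [Real.sqrt_mul_self_eq_abs]

end spectralMap

theorem posSemidef_trace_smul_one_sub {X : Type} [Fintype X] [DecidableEq X] {A : Op X}
    (hA : A.PosSemidef) : (A.trace • (1 : Op X) - A).PosSemidef := by
  have h := spectralMap_posSemidef' hA.1
    (f := fun x => (∑ j, hA.1.eigenvalues j) * 1 - x) fun i => by
      rw [mul_one, sub_nonneg]
      exact Finset.single_le_sum (fun j _ => hA.eigenvalues_nonneg j) (Finset.mem_univ i)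
  convert h using 1
  rw [spectralMap_sub, spectralMap_id]
  simp only [mul_one]
  rw [spectralMap_const, hA.1.trace_eq_sum_eigenvalues]
  simp

theorem trace_mul_le_traceNorm {X : Type} [Fintype X] [DecidableEq X] {H M : Op X}
    (hH : H.IsHermitian) (h0 : H.trace = 0) (hM : M.PosSemidef) (hM1 : (1 - M).PosSemidef) :
    2 * ((M * H).trace).re ≤ traceNorm H := by
  have hd : H = spectralMap hH (fun x => x⁺) - spectralMap hH (fun x => x⁻) := by
    rw [← spectralMap_sub]
    simp only [posPart_sub_negPart]
    exact (spectralMap_id hH).symm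
  have hP := spectralMap_posSemidef hH (f := fun x => x⁺) fun x => posPart_nonneg x
  have hN := spectralMap_posSemidef hH (f := fun x => x⁻) fun x => negPart_nonneg x
  have h1 := (Complex.nonneg_iff.mp (trace_mul_nonneg hM1 hP)).1
  have h2 := (Complex.nonneg_iff.mp (trace_mul_nonneg hM hN)).1
  have h3 : (M * H).trace = (M * spectralMap hH (fun x => x⁺)).trace -
      (M * spectralMap hH (fun x => x⁻)).trace := by
    rw [← trace_sub, ← mul_sub, ← hd]
  have h4 : (spectralMap hH (fun x => x⁺)).trace = (spectralMap hH (fun x => x⁻)).trace := by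
    rw [← sub_eq_zero, ← trace_sub, ← hd, h0]
  have h5 : traceNorm H = (spectralMap hH (fun x => x⁺)).trace.re +
      (spectralMap hH (fun x => x⁻)).trace.re := by
    rw [traceNorm_eq_sum_abs hH, trace_spectralMap, trace_spectralMap, Complex.ofReal_re,
      Complex.ofReal_re, ← Finset.sum_add_distrib]
    simp only [posPart_add_negPart]
  rw [sub_mul, trace_sub, one_mul, Complex.sub_re] at h1
  rw [h3, h5, ← h4, Complex.sub_re]
  linarith

theorem exists_traceNorm_eq_trace_mul {X : Type} [Fintype X] [DecidableEq X] {H : Op X}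
    (hH : H.IsHermitian) (h0 : H.trace = 0) :
    ∃ Q : Op X, Q.PosSemidef ∧ (1 - Q).PosSemidef ∧ traceNorm H = 2 * ((Q * H).trace).re := by
  refine ⟨spectralMap hH (fun x => if 0 < x then 1 else 0),
    spectralMap_posSemidef hH fun x => by split_ifs <;> norm_num, ?_, ?_⟩
  · rw [← spectralMap_one hH, ← spectralMap_sub]
    exact spectralMap_posSemidef hH fun x => by split_ifs <;> norm_num
  · have h1 : ∑ i, hH.eigenvalues i = 0 := by
      have := trace_spectralMap hH (fun x => x)
      rw [spectralMap_id, h0] at this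
      exact_mod_cast this.symm
    have h2 := spectralMap_mul hH (fun x => if 0 < x then 1 else 0) (fun x => x)
    rw [spectralMap_id] at h2
    have h3 : ∑ i, |hH.eigenvalues i| = ∑ i, |hH.eigenvalues i| + ∑ i, hH.eigenvalues i := by
      rw [h1, add_zero]
    rw [h2, trace_spectralMap, Complex.ofReal_re, traceNorm_eq_sum_abs hH, h3,
      ← Finset.sum_add_distrib, Finset.mul_sum]
    refine Finset.sum_congr rfl fun i _ => ?_
    split_ifs with h
    · rw [abs_of_pos h]; ring
    · rw [abs_of_nonpos (not_lt.mp h)]; ring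

/-! ### Linear maps between matrices and their Choi matrices -/

section Kernel

variable {X Y Z : Type}

theorem apply_eq_sum [Fintype X] [DecidableEq X] (Φ : QMap X Y) (M : Op X) (y y' : Y) :
    Φ M y y' = ∑ x, ∑ x', M x x' * Φ (single x x' 1) y y' := by
  conv_lhs => rw [matrix_eq_sum_single M]
  simp only [map_sum, Matrix.sum_apply]
  refine Finset.sum_congr rfl fun x _ => Finset.sum_congr rfl fun x' _ => ?_
  have h : single x x' (M x x') = M x x' • single x x' (1 : ℂ) := by simp
  rw [h, map_smul, Matrix.smul_apply, smul_eq_mul]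

theorem choi_apply [DecidableEq X] (Φ : QMap X Y) (y y' : Y) (x x' : X) :
    choi Φ (y, x) (y', x') = Φ (single x x' 1) y y' := by
  change Φ _ y y' = _
  have h : (of fun a a' => maxEnt X (a, x) (a', x')) = single x x' 1 :=
    Matrix.ext fun a a' => by simp [maxEnt, single, eq_comm]
  exact congrFun (congrFun (congrArg Φ h) y) y'

theorem apply_eq_sum_choi [Fintype X] [DecidableEq X] (Φ : QMap X Y) (M : Op X) (y y' : Y) :
    Φ M y y' = ∑ x, ∑ x', M x x' * choi Φ (y, x) (y', x') := by
  simp only [choi_apply]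
  exact apply_eq_sum Φ M y y'

theorem choi_add [DecidableEq X] (Φ Ψ : QMap X Y) : choi (Φ + Ψ) = choi Φ + choi Ψ := rfl

theorem choi_sub [DecidableEq X] (Φ Ψ : QMap X Y) : choi (Φ - Ψ) = choi Φ - choi Ψ := rfl

theorem choi_smul [DecidableEq X] (c : ℝ) (Φ : QMap X Y) : choi (c • Φ) = c • choi Φ := rfl

/-- The map with a given Choi matrix. -/
def ofChoi [Fintype X] (C : Op (Y × X)) : QMap X Y where
  toFun M := of fun y y' => ∑ x, ∑ x', M x x' * C (y, x) (y', x')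
  map_add' M N := by
    ext y y'
    simp [add_mul, Finset.sum_add_distrib]
  map_smul' c M := by
    ext y y'
    simp [mul_assoc, Finset.mul_sum]

theorem ofChoi_apply [Fintype X] (C : Op (Y × X)) (M : Op X) (y y' : Y) :
    ofChoi C M y y' = ∑ x, ∑ x', M x x' * C (y, x) (y', x') := rfl

theorem choi_ofChoi [Fintype X] [DecidableEq X] (C : Op (Y × X)) : choi (ofChoi C) = C := by
  ext ⟨y, x⟩ ⟨y', x'⟩
  rw [choi_apply, ofChoi_apply]
  simp [single, ite_and]

end Kernel

/-! ### Complete positivity -/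

section CP

variable {X Y Z : Type}

theorem ampR_apply (Φ : QMap X Y) (M : Op (X × Z)) (p q : Y × Z) :
    ampR Φ Z M p q = Φ (of fun x x' => M (x, p.2) (x', q.2)) p.1 q.1 := rfl

theorem ampL_apply (Φ : QMap X Y) (M : Op (Z × X)) (p q : Z × Y) :
    ampL Z Φ M p q = Φ (of fun x x' => M (p.1, x) (q.1, x')) p.2 q.2 := rfl

theorem relabel_apply (e : X ≃ Y) (M : Op X) : relabel e M = M.submatrix e.symm e.symm := rfl

/-- The map `M ↦ V M Vᴴ`. -/
def conjMap [Fintype X] (V : Matrix Y X ℂ) : QMap X Y where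
  toFun M := V * M * Vᴴ
  map_add' M N := by rw [Matrix.mul_add, Matrix.add_mul]
  map_smul' c M := by simp

theorem conjMap_apply [Fintype X] (V : Matrix Y X ℂ) (M : Op X) : conjMap V M = V * M * Vᴴ := rfl

theorem ampR_conjMap [Fintype X] [Fintype Z] [DecidableEq Z] (V : Matrix Y X ℂ) (M : Op (X × Z)) :
    ampR (conjMap V) Z M = (V ⊗ₖ (1 : Op Z)) * M * (V ⊗ₖ (1 : Op Z))ᴴ := by
  ext ⟨y, z⟩ ⟨y', z'⟩
  simp [ampR_apply, conjMap_apply, mul_apply, Fintype.sum_prod_type, one_apply, ite_mul,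
    Finset.sum_ite_eq, apply_ite]

theorem isCP_conjMap [Fintype X] [Finite Y] (V : Matrix Y X ℂ) : IsCP (conjMap V) := by
  have := Fintype.ofFinite Y
  intro n M hM
  rw [ampR_conjMap]
  exact hM.mul_mul_conjTranspose_same _

theorem IsCP.zero : IsCP (0 : QMap X Y) := fun _ _ _ => PosSemidef.zero

theorem IsCP.add {Φ Ψ : QMap X Y} (hΦ : IsCP Φ) (hΨ : IsCP Ψ) : IsCP (Φ + Ψ) :=
  fun n M hM => (hΦ n M hM).add (hΨ n M hM)

theorem IsCP.smul {Φ : QMap X Y} (hΦ : IsCP Φ) {c : ℝ} (hc : 0 ≤ c) : IsCP (c • Φ) :=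
  fun n M hM => (hΦ n M hM).smul hc

theorem IsCP.sum {J : Type} {s : Finset J} {Φ : J → QMap X Y} (hΦ : ∀ j ∈ s, IsCP (Φ j)) :
    IsCP (∑ j ∈ s, Φ j) := by
  classical
  induction s using Finset.induction_on with
  | empty => simpa using IsCP.zero
  | insert a s ha ih =>
    rw [Finset.sum_insert ha]
    exact (hΦ a (by simp)).add (ih fun j hj => hΦ j (by simp [hj]))

theorem isCP_of_posSemidef_choi [Fintype X] [DecidableEq X] [Finite Y] {Φ : QMap X Y}
    (h : (choi Φ).PosSemidef) : IsCP Φ := by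
  have := Fintype.ofFinite Y
  obtain ⟨m, v, hv⟩ := posSemidef_iff_eq_sum_vecMulVec.mp h
  have : Φ = ∑ k, conjMap (of fun y x => v k (y, x)) := by
    refine LinearMap.ext fun M => ?_
    ext y y'
    rw [apply_eq_sum_choi, hv]
    simp only [LinearMap.sum_apply, Matrix.sum_apply, conjMap_apply, mul_apply, vecMulVec_apply,
      conjTranspose_apply, of_apply, Finset.mul_sum, Finset.sum_mul, Pi.star_apply]
    rw [Finset.sum_comm_cycle]
    refine Finset.sum_congr rfl fun k _ => ?_
    rw [Finset.sum_comm]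
    refine Finset.sum_congr rfl fun x _ => Finset.sum_congr rfl fun x' _ => by ring
  rw [this]
  exact IsCP.sum fun k _ => isCP_conjMap _

theorem IsCP.posSemidef_ampR {Φ : QMap X Y} (hΦ : IsCP Φ) [Finite Z] {M : Op (X × Z)}
    (hM : M.PosSemidef) : (ampR Φ Z M).PosSemidef := by
  obtain ⟨n, ⟨e⟩⟩ := Finite.exists_equiv_fin Z
  have h := (hΦ n _ (hM.submatrix (Prod.map id e.symm))).submatrix (Prod.map id e)
  convert h using 1
  ext ⟨y, z⟩ ⟨y', z'⟩
  simp [ampR_apply]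

theorem IsCP.posSemidef_apply {Φ : QMap X Y} (hΦ : IsCP Φ) {M : Op X}
    (hM : M.PosSemidef) : (Φ M).PosSemidef :=
  (hΦ.posSemidef_ampR (Z := Unit) (hM.submatrix Prod.fst)).submatrix fun y => (y, ())

theorem maxEnt_posSemidef [Finite X] [DecidableEq X] : (maxEnt X).PosSemidef := by
  have := Fintype.ofFinite X
  convert posSemidef_vecMulVec_self_star (fun p : X × X => if p.1 = p.2 then (1 : ℂ) else 0) using 1
  ext p q
  by_cases h : p.1 = p.2 <;> by_cases h' : q.1 = q.2 <;> simp [maxEnt, vecMulVec_apply, h, h']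

theorem IsCP.posSemidef_choi [Finite X] [DecidableEq X] {Φ : QMap X Y} (hΦ : IsCP Φ) :
    (choi Φ).PosSemidef :=
  hΦ.posSemidef_ampR maxEnt_posSemidef

theorem IsCP.comp {Φ : QMap Y Z} {Ψ : QMap X Y} (hΦ : IsCP Φ) (hΨ : IsCP Ψ) : IsCP (Φ ∘ₗ Ψ) :=
  fun n M hM => hΦ n _ (hΨ n M hM)

theorem IsCP.id : IsCP (LinearMap.id : QMap X X) := fun _ _ hM => hM

theorem isCP_relabel (e : X ≃ Y) : IsCP (relabel e) :=
  fun _ _ hM => hM.submatrix (Prod.map e.symm (_root_.id : _ → _))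

theorem IsCP.ampR {Φ : QMap X Y} (hΦ : IsCP Φ) (Z : Type) [Finite Z] : IsCP (ampR Φ Z) :=
  fun n M hM => by
    have h : QLOCC.ampR (QLOCC.ampR Φ Z) (Fin n) M = (QLOCC.ampR Φ (Z × Fin n)
        (M.submatrix (fun p : X × Z × Fin n => ((p.1, p.2.1), p.2.2))
          (fun p : X × Z × Fin n => ((p.1, p.2.1), p.2.2)))).submatrix
        (fun p : (Y × Z) × Fin n => (p.1.1, (p.1.2, p.2)))
        (fun p : (Y × Z) × Fin n => (p.1.1, (p.1.2, p.2))) := rfl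
    rw [h]
    exact (hΦ.posSemidef_ampR (hM.submatrix _)).submatrix _

theorem IsCP.ampL {Φ : QMap X Y} (hΦ : IsCP Φ) (Z : Type) [Finite Z] : IsCP (ampL Z Φ) :=
  have h : QLOCC.ampL Z Φ = (relabel (Equiv.prodComm Y Z) ∘ₗ QLOCC.ampR Φ Z) ∘ₗ
      relabel (Equiv.prodComm Z X) := rfl
  h ▸ ((isCP_relabel _).comp (hΦ.ampR Z)).comp (isCP_relabel _)

theorem trace_ampR [Fintype Y] [Fintype Z] (Φ : QMap X Y) (M : Op (X × Z)) :
    (ampR Φ Z M).trace = ∑ z, (Φ (of fun x x' => M (x, z) (x', z))).trace := by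
  simp only [trace, diag_apply, Fintype.sum_prod_type, ampR_apply]
  rw [Finset.sum_comm]

theorem trace_ampL [Fintype Y] [Fintype Z] (Φ : QMap X Y) (M : Op (Z × X)) :
    (ampL Z Φ M).trace = ∑ z, (Φ (of fun x x' => M (z, x) (z, x'))).trace := by
  simp only [trace, diag_apply, Fintype.sum_prod_type, ampL_apply]

/-- The map `M ↦ tr(M) τ`. -/
def replaceMap [Fintype X] (τ : Op Y) : QMap X Y := (traceLinearMap X ℂ ℂ).smulRight τ

theorem replaceMap_apply [Fintype X] (τ : Op Y) (M : Op X) : replaceMap τ M = M.trace • τ := rfl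

end CP

/-! ### Channels and instruments -/

section Channel

variable {X Y Z J : Type} [Fintype X] [Fintype Y] [Fintype Z] [Fintype J]

theorem trace_relabel (e : X ≃ Y) (M : Op X) : (relabel e M).trace = M.trace := by
  simp only [trace, diag_apply, relabel_apply, submatrix_apply]
  exact Equiv.sum_comp e.symm fun x => M x x

theorem isChannel_relabel (e : X ≃ Y) : IsChannel (relabel e) :=
  ⟨isCP_relabel e, trace_relabel e⟩

theorem IsChannel.comp {Φ : QMap Y Z} {Ψ : QMap X Y} (hΦ : IsChannel Φ) (hΨ : IsChannel Ψ) :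
    IsChannel (Φ ∘ₗ Ψ) :=
  ⟨hΦ.1.comp hΨ.1, fun M => by rw [LinearMap.comp_apply, hΦ.2, hΨ.2]⟩

theorem isChannel_id : IsChannel (LinearMap.id : QMap X X) := ⟨IsCP.id, fun _ => rfl⟩

theorem IsInstrument.ampR {F : J → QMap X Y} (hF : IsInstrument F) (Z : Type) [Fintype Z] :
    IsInstrument fun j => ampR (F j) Z := by
  refine ⟨fun j => (hF.1 j).ampR Z, fun M => ?_⟩
  simp only [trace_ampR]
  rw [Finset.sum_comm]
  simp only [hF.2]
  simp only [trace, diag_apply, Fintype.sum_prod_type, of_apply]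
  rw [Finset.sum_comm]

theorem IsInstrument.ampL {F : J → QMap X Y} (hF : IsInstrument F) (Z : Type) [Fintype Z] :
    IsInstrument fun j => ampL Z (F j) := by
  refine ⟨fun j => (hF.1 j).ampL Z, fun M => ?_⟩
  simp only [trace_ampL]
  rw [Finset.sum_comm]
  simp only [hF.2]
  simp only [trace, diag_apply, Fintype.sum_prod_type, of_apply]

theorem isInstrument_const_iff {Φ : QMap X Y} :
    IsInstrument (fun _ : Unit => Φ) ↔ IsChannel Φ := by
  simp [IsInstrument, IsChannel]

theorem IsChannel.ampR {Φ : QMap X Y} (hΦ : IsChannel Φ) (Z : Type) [Fintype Z] :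
    IsChannel (ampR Φ Z) :=
  isInstrument_const_iff.mp ((isInstrument_const_iff.mpr hΦ).ampR Z)

theorem IsChannel.ampL {Φ : QMap X Y} (hΦ : IsChannel Φ) (Z : Type) [Fintype Z] :
    IsChannel (ampL Z Φ) :=
  isInstrument_const_iff.mp ((isInstrument_const_iff.mpr hΦ).ampL Z)

theorem IsChannel.tens {X' Y' : Type} [Fintype X'] [Fintype Y'] {Φ : QMap X X'} {Ψ : QMap Y Y'}
    (hΦ : IsChannel Φ) (hΨ : IsChannel Ψ) : IsChannel (tens Φ Ψ) :=
  (hΨ.ampL X').comp (hΦ.ampR Y)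

theorem IsState.apply {Φ : QMap X Y} (hΦ : IsChannel Φ) {ρ : Op X} (hρ : IsState ρ) :
    IsState (Φ ρ) :=
  ⟨hΦ.1.posSemidef_apply hρ.1, (hΦ.2 ρ).trans hρ.2⟩

theorem isChannel_conjMap [DecidableEq X] {V : Matrix Y X ℂ} (hV : Vᴴ * V = 1) :
    IsChannel (conjMap V) :=
  ⟨isCP_conjMap V, fun M => by rw [conjMap_apply, trace_mul_cycle, hV, one_mul]⟩

/-- The partial trace over the first factor. -/
def trFst (M : Op (Y × X)) : Op X := of fun x x' => ∑ y, M (y, x) (y, x')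

theorem trace_trFst (M : Op (Y × X)) : (trFst M).trace = M.trace := by
  simp only [trace, diag_apply, trFst, of_apply, Fintype.sum_prod_type]
  rw [Finset.sum_comm]

theorem trace_apply_eq_sum_choi [DecidableEq X] (Φ : QMap X Y) (M : Op X) :
    (Φ M).trace = ∑ x, ∑ x', M x x' * trFst (choi Φ) x x' := by
  simp only [trace, diag_apply, apply_eq_sum_choi, trFst, of_apply, Finset.mul_sum]
  rw [Finset.sum_comm_cycle, Finset.sum_comm_cycle]

theorem trFst_choi [DecidableEq X] {Φ : QMap X Y} (hΦ : IsChannel Φ) : trFst (choi Φ) = 1 := by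
  ext x x'
  simp only [trFst, of_apply, choi_apply]
  refine (hΦ.2 (single x x' 1)).trans ?_
  rw [one_apply]
  split_ifs with h
  · subst h; simp
  · simp [h]

theorem isChannel_of_choi [DecidableEq X] {Φ : QMap X Y} (h : (choi Φ).PosSemidef)
    (h1 : trFst (choi Φ) = 1) : IsChannel Φ := by
  refine ⟨isCP_of_posSemidef_choi h, fun M => ?_⟩
  rw [trace_apply_eq_sum_choi, h1]
  simp [one_apply, trace]

theorem isChannel_replaceMap {τ : Op Y} (hτ : IsState τ) :
    IsChannel (replaceMap τ : QMap X Y) := by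
  classical
  have h : choi (replaceMap τ : QMap X Y) = τ ⊗ₖ (1 : Op X) := by
    refine Matrix.ext fun p q => ?_
    rw [choi_apply, replaceMap_apply, Matrix.smul_apply, kroneckerMap_apply, smul_eq_mul, mul_comm,
      one_apply]
    split_ifs with h
    · rw [h]; simp
    · simp [h]
  refine isChannel_of_choi ?_ ?_
  · rw [h]
    exact hτ.1.kronecker PosSemidef.one
  · ext x x'
    have h1 : ∑ y, τ y y = 1 := hτ.2
    simp only [h, trFst, of_apply, kroneckerMap_apply]
    refine (Finset.sum_mul Finset.univ (fun y => τ y y) ((1 : Op X) x x')).symm.trans ?_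
    rw [h1, one_mul]

/-- The maximally mixed state. -/
def mixed (X : Type) [Fintype X] [DecidableEq X] : Op X := ((Fintype.card X : ℝ)⁻¹) • 1

theorem isState_mixed [DecidableEq X] [Nonempty X] : IsState (mixed X) := by
  refine ⟨PosSemidef.one.smul (by positivity), ?_⟩
  simp [mixed, trace_smul]

end Channel

/-! ### The pairing and the norms -/

section Pairing

variable {X Y : Type} [Fintype X] [Fintype Y]

theorem pairing_eq_re_sum (ρ : Op (X × Y)) (φ : QMap X Y) :
    pairing ρ φ = (∑ y, ∑ y', φ (of fun x x' => ρ (x, y) (x', y')) y y').re := rfl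

theorem pairing_add_right (ρ : Op (X × Y)) (φ ψ : QMap X Y) :
    pairing ρ (φ + ψ) = pairing ρ φ + pairing ρ ψ := by
  simp [pairing_eq_re_sum, Finset.sum_add_distrib]

theorem pairing_sub_right (ρ : Op (X × Y)) (φ ψ : QMap X Y) :
    pairing ρ (φ - ψ) = pairing ρ φ - pairing ρ ψ := by
  simp [pairing_eq_re_sum, Finset.sum_sub_distrib]

theorem pairing_smul_right (ρ : Op (X × Y)) (c : ℝ) (φ : QMap X Y) :
    pairing ρ (c • φ) = c * pairing ρ φ := by
  simp only [pairing_eq_re_sum, LinearMap.smul_apply, Matrix.smul_apply, ← Finset.smul_sum,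
    Complex.smul_re, smul_eq_mul]

/-- The operator on `Y × X` that represents the pairing with an operator on `X × Y` through
Choi matrices. -/
def pairOp (ρ : Op (X × Y)) : Op (Y × X) := ρᵀ.submatrix Prod.swap Prod.swap

theorem pairOp_pairOp (ρ : Op (X × Y)) : pairOp (pairOp ρ) = ρ := rfl

theorem isState_pairOp {ρ : Op (X × Y)} (hρ : IsState ρ) : IsState (pairOp ρ) := by
  refine ⟨hρ.1.transpose.submatrix _, ?_⟩
  rw [← hρ.2]
  simp only [trace, diag_apply, pairOp, submatrix_apply, transpose_apply]
  exact Equiv.sum_comp (Equiv.prodComm Y X) fun p => ρ p p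

theorem pairing_eq_trace [DecidableEq X] (ρ : Op (X × Y)) (φ : QMap X Y) :
    pairing ρ φ = ((choi φ * pairOp ρ).trace).re := by
  rw [pairing_eq_re_sum]
  congr 1
  simp only [trace, diag_apply, mul_apply, Fintype.sum_prod_type, apply_eq_sum_choi, of_apply,
    pairOp, submatrix_apply, transpose_apply, Prod.swap_prod_mk]
  refine Finset.sum_congr rfl fun y _ => ?_
  rw [Finset.sum_comm]
  refine Finset.sum_congr rfl fun x _ => ?_
  refine Finset.sum_congr rfl fun y' _ => Finset.sum_congr rfl fun x' _ => mul_comm _ _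

theorem pairing_nonneg {ρ : Op (X × Y)} (hρ : ρ.PosSemidef) {φ : QMap X Y} (hφ : IsCP φ) :
    0 ≤ pairing ρ φ := by
  classical
  rw [pairing_eq_trace]
  exact (Complex.nonneg_iff.mp (trace_mul_nonneg hφ.posSemidef_choi
    (hρ.transpose.submatrix Prod.swap))).1

theorem pairing_mono {ρ : Op (X × Y)} (hρ : ρ.PosSemidef) {φ ψ : QMap X Y} (h : IsCP (ψ - φ)) :
    pairing ρ φ ≤ pairing ρ ψ := by
  have := pairing_nonneg hρ h
  rw [pairing_sub_right] at this
  linarith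

theorem pairing_le_card {ρ : Op (X × Y)} (hρ : IsState ρ) {α : QMap X Y} (hα : IsChannel α) :
    pairing ρ α ≤ Fintype.card X := by
  classical
  have h1 := hα.1.posSemidef_choi
  have h2 := Complex.nonneg_iff.mp
    (trace_mul_nonneg (posSemidef_trace_smul_one_sub h1) (isState_pairOp hρ).1)
  have h3 : (choi α).trace = Fintype.card X := by
    rw [← trace_trFst, trFst_choi hα, trace_one]
  rw [h3, sub_mul, trace_sub, smul_mul_assoc, one_mul, trace_smul, (isState_pairOp hρ).2] at h2
  rw [pairing_eq_trace]
  have := h2.1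
  simp at this
  exact this

theorem pairing_replaceMap_mixed [DecidableEq Y] (ρ : Op (X × Y)) :
    pairing ρ (replaceMap (mixed Y)) = (Fintype.card Y : ℝ)⁻¹ * ρ.trace.re := by
  rw [pairing_eq_re_sum]
  simp only [replaceMap_apply, mixed, Matrix.smul_apply, one_apply, trace, diag_apply, of_apply,
    Fintype.sum_prod_type]
  simp [Finset.sum_mul, Finset.mul_sum]
  rw [Finset.sum_comm]
  exact Finset.sum_congr rfl fun _ _ => Finset.sum_congr rfl fun _ _ => mul_comm _ _

theorem le_dualDiamondNorm {ρ : Op (X × Y)} (hρ : IsState ρ) {α : QMap X Y} (hα : IsChannel α) :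
    pairing ρ α ≤ dualDiamondNorm ρ := by
  refine le_csSup ⟨Fintype.card X, ?_⟩ ⟨α, α, hα, by simpa using IsCP.zero, hα.1.add hα.1, rfl⟩
  rintro r ⟨φ, β, hβ, h1, -, rfl⟩
  exact (pairing_mono hρ.1 h1).trans (pairing_le_card hρ hβ)

theorem dualDiamondNorm_le {ρ : Op (X × Y)} (hρ : IsState ρ) {c : ℝ} (hc : 0 ≤ c)
    (h : ∀ α : QMap X Y, IsChannel α → pairing ρ α ≤ c) : dualDiamondNorm ρ ≤ c := by
  refine Real.sSup_le ?_ hc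
  rintro r ⟨φ, α, hα, h1, -, rfl⟩
  exact (pairing_mono hρ.1 h1).trans (h α hα)

theorem dualDiamondNorm_pos [Nonempty Y] {ρ : Op (X × Y)} (hρ : IsState ρ) :
    0 < dualDiamondNorm ρ := by
  classical
  refine lt_of_lt_of_le ?_ (le_dualDiamondNorm hρ (isChannel_replaceMap (isState_mixed (X := Y))))
  rw [pairing_replaceMap_mixed, hρ.2]
  simp [Fintype.card_pos]

end Pairing

section Diamond

variable {X Y : Type} [Fintype X] [Fintype Y] [DecidableEq X] [DecidableEq Y]

theorem isHermitian_choi {φ : QMap X Y} (hφ : IsCP φ) : (choi φ).IsHermitian :=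
  hφ.posSemidef_choi.1

theorem diamondNorm_nonneg (φ : QMap X Y) : 0 ≤ diamondNorm φ := by
  refine Real.sSup_nonneg ?_
  rintro r ⟨ρ, -, rfl⟩
  exact Finset.sum_nonneg fun _ _ => Real.sqrt_nonneg _

theorem isHermitian_ampR_sub_and_trace {Φ Ψ : QMap X Y} (hΦ : IsChannel Φ) (hΨ : IsChannel Ψ)
    {ρ : Op (X × X)} (hρ : IsState ρ) :
    (ampR (Φ - Ψ) X ρ).IsHermitian ∧ (ampR (Φ - Ψ) X ρ).trace = 0 := by
  have h : ampR (Φ - Ψ) X ρ = ampR Φ X ρ - ampR Ψ X ρ := rfl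
  have h1 := IsState.apply (hΦ.ampR X) hρ
  have h2 := IsState.apply (hΨ.ampR X) hρ
  rw [h]
  exact ⟨h1.1.1.sub h2.1.1, by rw [trace_sub, h1.2, h2.2, sub_self]⟩

theorem traceNorm_ampR_sub_le {Φ Ψ α : QMap X Y} (hΦ : IsChannel Φ) (hΨ : IsChannel Ψ)
    (hα : IsChannel α) {c : ℝ} (hc : 0 ≤ c) (h : IsCP (c • α - (Φ - Ψ)))
    {ρ : Op (X × X)} (hρ : IsState ρ) : traceNorm (ampR (Φ - Ψ) X ρ) ≤ 2 * c := by
  obtain ⟨hH, h0⟩ := isHermitian_ampR_sub_and_trace hΦ hΨ hρ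
  obtain ⟨Q, hQ, hQ1, hQH⟩ := exists_traceNorm_eq_trace_mul hH h0
  have h1 := Complex.nonneg_iff.mp (trace_mul_nonneg hQ (h.posSemidef_ampR (Z := X) hρ.1))
  have hα' := IsState.apply (hα.ampR X) hρ
  have h2 := Complex.nonneg_iff.mp (trace_mul_nonneg hQ1 hα'.1)
  have h3 : ampR (c • α - (Φ - Ψ)) X ρ = c • ampR α X ρ - ampR (Φ - Ψ) X ρ := rfl
  rw [h3, mul_sub, trace_sub, mul_smul_comm, Complex.sub_re, trace_re_smul] at h1
  rw [sub_mul, one_mul, trace_sub, hα'.2, Complex.sub_re, Complex.one_re] at h2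
  rw [hQH]
  have := mul_le_mul_of_nonneg_left (sub_nonneg.mp h2.1) hc
  linarith [h1.1]

theorem diamondNorm_sub_le {Φ Ψ α : QMap X Y} (hΦ : IsChannel Φ) (hΨ : IsChannel Ψ)
    (hα : IsChannel α) {c : ℝ} (hc : 0 ≤ c) (h : IsCP (c • α - (Φ - Ψ))) :
    diamondNorm (Φ - Ψ) ≤ 2 * c := by
  refine Real.sSup_le ?_ (by linarith)
  rintro r ⟨ρ, hρ, rfl⟩
  exact traceNorm_ampR_sub_le hΦ hΨ hα hc h hρ

theorem traceNorm_le_diamondNorm_sub {Φ Ψ : QMap X Y} (hΦ : IsChannel Φ) (hΨ : IsChannel Ψ)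
    {ρ : Op (X × X)} (hρ : IsState ρ) :
    traceNorm (ampR (Φ - Ψ) X ρ) ≤ diamondNorm (Φ - Ψ) := by
  refine le_csSup ⟨2, ?_⟩ ⟨ρ, hρ, rfl⟩
  rintro r ⟨ρ, hρ, rfl⟩
  simpa using traceNorm_ampR_sub_le hΦ hΨ hΦ zero_le_one (by simpa using hΨ.1) hρ

theorem ampR_conj_right (φ : QMap X Y) (s t : Op X) (M : Op (X × X)) :
    ampR φ X (((1 : Op X) ⊗ₖ s) * M * ((1 : Op X) ⊗ₖ t)) =
      ((1 : Op Y) ⊗ₖ s) * ampR φ X M * ((1 : Op Y) ⊗ₖ t) := by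
  ext ⟨y, z⟩ ⟨y', z'⟩
  have h : (of fun x x' => (((1 : Op X) ⊗ₖ s) * M * ((1 : Op X) ⊗ₖ t)) (x, z) (x', z')) =
      ∑ w', ∑ w, (s z w * t w' z') • of fun x x' => M (x, w) (x', w') := by
    ext x x'
    simp [mul_apply, Fintype.sum_prod_type, one_apply, ite_mul, Matrix.sum_apply,
      Finset.sum_mul]
    exact Finset.sum_congr rfl fun _ _ => Finset.sum_congr rfl fun _ _ => by ring
  rw [ampR_apply]
  simp only [h, map_sum, map_smul]
  simp [mul_apply, Fintype.sum_prod_type, one_apply, ite_mul, Matrix.sum_apply,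
      Finset.sum_mul, ampR_apply]
  exact Finset.sum_congr rfl fun _ _ => Finset.sum_congr rfl fun _ _ => by ring

theorem trace_maxEnt_mul (s : Op X) : (maxEnt X * ((1 : Op X) ⊗ₖ s)).trace = s.trace := by
  simp [trace, mul_apply, Fintype.sum_prod_type, one_apply, maxEnt, ite_and]

end Diamond

/-! ### Domination by a multiple of a channel -/

section Domination

variable {X Y : Type} [Fintype X] [Fintype Y] [DecidableEq X] [DecidableEq Y]

theorem trace_mul_one_kronecker (Z : Op (Y × X)) (σ : Op X) :
    (Z * ((1 : Op Y) ⊗ₖ σ)).trace = (trFst Z * σ).trace := by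
  simp [trace, mul_apply, Fintype.sum_prod_type, one_apply, trFst, Finset.sum_mul, ite_mul]
  rw [Finset.sum_comm]
  refine Finset.sum_congr rfl fun _ _ => Finset.sum_comm

theorem trFst_posSemidef {Z : Op (Y × X)} (hZ : Z.PosSemidef) : (trFst Z).PosSemidef := by
  have h : trFst Z = ∑ y, Z.submatrix (fun x => (y, x)) (fun x => (y, x)) := by
    ext x x'
    simp [trFst, Matrix.sum_apply]
  rw [h]
  exact posSemidef_sum _ fun y _ => hZ.submatrix _

theorem trFst_kronecker (τ : Op Y) (R : Op X) : trFst (τ ⊗ₖ R) = τ.trace • R := by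
  ext x x'
  simp [trFst, trace, Finset.sum_mul]

open scoped MatrixOrder in
theorem exists_sqrt_of_posDef {σ : Op X} (hσ : σ.PosDef) :
    ∃ s : Op X, s.IsHermitian ∧ s * s = σ ∧ IsUnit s.det := by
  have hss : CFC.sqrt σ * CFC.sqrt σ = σ := CFC.sqrt_mul_sqrt_self σ hσ.posSemidef.nonneg
  refine ⟨CFC.sqrt σ, (CFC.sqrt_nonneg σ).posSemidef.1, hss, ?_⟩
  have h : (CFC.sqrt σ).det * (CFC.sqrt σ).det = σ.det := by rw [← det_mul, hss]
  exact isUnit_iff_ne_zero.mpr fun h0 => hσ.det_pos.ne' (by rw [← h, h0, zero_mul])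

/-- Weak duality for the diamond norm. -/
theorem trace_choi_mul_le_of_posDef {Φ Ψ : QMap X Y} (hΦ : IsChannel Φ) (hΨ : IsChannel Ψ)
    {w : Op (Y × X)} (hw : w.PosSemidef) {σ : Op X} (hσ : σ.PosDef) (hσ0 : 0 < σ.trace.re)
    (h : ((1 : Op Y) ⊗ₖ σ - w).PosSemidef) :
    2 * ((choi (Φ - Ψ) * w).trace).re ≤ diamondNorm (Φ - Ψ) * σ.trace.re := by
  obtain ⟨s, hsH, hss, hsu⟩ := exists_sqrt_of_posDef hσ
  have hs1 : s * s⁻¹ = 1 := mul_nonsing_inv _ hsu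
  have hs2 : s⁻¹ * s = 1 := nonsing_inv_mul _ hsu
  have hsiH : (s⁻¹).IsHermitian := hsH.inv
  set C := choi (Φ - Ψ) with hC
  set t := σ.trace.re with ht
  have hkH : ∀ {r : Op X}, r.IsHermitian → ((1 : Op Y) ⊗ₖ r)ᴴ = (1 : Op Y) ⊗ₖ r := by
    intro r hr
    rw [conjTranspose_kronecker, conjTranspose_one, hr.eq]
  have hkH' : ∀ {r : Op X}, r.IsHermitian → ((1 : Op X) ⊗ₖ r)ᴴ = (1 : Op X) ⊗ₖ r := by
    intro r hr
    rw [conjTranspose_kronecker, conjTranspose_one, hr.eq]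
  -- the state and the test operator
  set ω₀ : Op (X × X) := ((1 : Op X) ⊗ₖ s) * maxEnt X * ((1 : Op X) ⊗ₖ s) with hω₀
  have hω₀P : ω₀.PosSemidef := by
    have := maxEnt_posSemidef (X := X) |>.mul_mul_conjTranspose_same ((1 : Op X) ⊗ₖ s)
    rwa [hkH' hsH] at this
  have hω₀t : ω₀.trace = σ.trace := by
    rw [hω₀, mul_assoc, trace_mul_comm, mul_assoc, ← mul_kronecker_mul, mul_one, hss,
      trace_maxEnt_mul]
  have hσt : σ.trace = (t : ℂ) := by
    have h0 := Complex.nonneg_iff.mp hσ.posSemidef.trace_nonneg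
    exact Complex.ext (by simp [ht]) (by simpa using h0.2.symm)
  have hω : IsState (t⁻¹ • ω₀) := by
    refine ⟨hω₀P.smul (inv_nonneg.mpr hσ0.le), ?_⟩
    rw [trace_smul, hω₀t, hσt, Complex.real_smul, ← Complex.ofReal_mul, inv_mul_cancel₀ hσ0.ne',
      Complex.ofReal_one]
  obtain ⟨hH, h0⟩ := isHermitian_ampR_sub_and_trace hΦ hΨ hω
  have hHe : ampR (Φ - Ψ) X (t⁻¹ • ω₀) =
      t⁻¹ • (((1 : Op Y) ⊗ₖ s) * C * ((1 : Op Y) ⊗ₖ s)) := by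
    rw [hC, choi, ← ampR_conj_right]
    exact LinearMap.map_smul_of_tower _ _ _
  set M : Op (Y × X) := ((1 : Op Y) ⊗ₖ s⁻¹) * w * ((1 : Op Y) ⊗ₖ s⁻¹) with hM
  have hMP : M.PosSemidef := by
    have := hw.mul_mul_conjTranspose_same ((1 : Op Y) ⊗ₖ s⁻¹)
    rwa [hkH hsiH] at this
  have hM1 : (1 - M).PosSemidef := by
    have := h.mul_mul_conjTranspose_same ((1 : Op Y) ⊗ₖ s⁻¹)
    rw [hkH hsiH, mul_sub, sub_mul, ← mul_kronecker_mul, ← mul_kronecker_mul, ← hss,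
      ← mul_assoc, hs2, Matrix.one_mul s, hs1, mul_one, mul_one, one_kronecker_one] at this
    exact this
  have h1 := trace_mul_le_traceNorm hH h0 hMP hM1
  have h2 := h1.trans (traceNorm_le_diamondNorm_sub hΦ hΨ hω)
  have h3 : (M * (((1 : Op Y) ⊗ₖ s) * C * ((1 : Op Y) ⊗ₖ s))).trace = (C * w).trace := by
    have e1 : ((1 : Op Y) ⊗ₖ s⁻¹) * ((1 : Op Y) ⊗ₖ s) = 1 := by
      rw [← mul_kronecker_mul, hs2, mul_one, one_kronecker_one]
    have e2 : ((1 : Op Y) ⊗ₖ s) * ((1 : Op Y) ⊗ₖ s⁻¹) = 1 := by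
      rw [← mul_kronecker_mul, hs1, mul_one, one_kronecker_one]
    rw [← mul_assoc, trace_mul_comm, hM]
    simp only [← mul_assoc]
    rw [e2, one_mul, mul_assoc w, e1, mul_one, trace_mul_comm]
  rw [hHe, mul_smul_comm, trace_re_smul, h3] at h2
  have h4 := mul_le_mul_of_nonneg_right h2 hσ0.le
  calc 2 * ((C * w).trace).re = 2 * (t⁻¹ * ((C * w).trace).re) * t := by
        field_simp
    _ ≤ _ := h4

theorem trace_choi_mul_le {Φ Ψ : QMap X Y} (hΦ : IsChannel Φ) (hΨ : IsChannel Ψ) [Nonempty X]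
    {w : Op (Y × X)} (hw : w.PosSemidef) {σ : Op X} (hσ : σ.PosSemidef)
    (h : ((1 : Op Y) ⊗ₖ σ - w).PosSemidef) :
    2 * ((choi (Φ - Ψ) * w).trace).re ≤ diamondNorm (Φ - Ψ) * σ.trace.re := by
  have hdelta : ∀ δ : ℝ, 0 < δ → 2 * ((choi (Φ - Ψ) * w).trace).re ≤
      diamondNorm (Φ - Ψ) * (σ.trace.re + δ * Fintype.card X) := by
    intro δ hδ
    have hd : (σ + δ • (1 : Op X)).PosDef := PosDef.posSemidef_add hσ (PosDef.one.smul hδ)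
    have ht : (σ + δ • (1 : Op X)).trace.re = σ.trace.re + δ * Fintype.card X := by
      simp [trace_add, trace_smul]
    have h0 := (Complex.nonneg_iff.mp hσ.trace_nonneg).1
    rw [← ht]
    refine trace_choi_mul_le_of_posDef hΦ hΨ hw hd ?_ ?_
    · rw [ht]
      have : (0 : ℝ) < Fintype.card X := by exact_mod_cast Fintype.card_pos
      positivity
    · have := h.add (PosSemidef.one (n := Y × X) (R := ℂ) |>.smul hδ.le)
      convert this using 1
      rw [kronecker_add, kronecker_smul, one_kronecker_one]
      abel
  refine le_of_forall_pos_le_add fun η hη => ?_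
  have hc : (0 : ℝ) < Fintype.card X := by exact_mod_cast Fintype.card_pos
  have hn := diamondNorm_nonneg (Φ - Ψ)
  have hD : 0 < diamondNorm (Φ - Ψ) + 1 := by linarith
  refine (hdelta (η / ((diamondNorm (Φ - Ψ) + 1) * Fintype.card X)) (by positivity)).trans ?_
  have e : η / ((diamondNorm (Φ - Ψ) + 1) * Fintype.card X) * Fintype.card X =
      η / (diamondNorm (Φ - Ψ) + 1) := by field_simp
  rw [e, mul_add]
  have : diamondNorm (Φ - Ψ) * (η / (diamondNorm (Φ - Ψ) + 1)) ≤ η := by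
    rw [mul_div_assoc', div_le_iff₀ hD]
    nlinarith
  linarith

theorem trace_fromBlocks_mul {A : Op Y} {B : Op X} (ρ : Op (Y ⊕ X)) :
    (fromBlocks A 0 0 B * ρ).trace = (A * ρ.toBlocks₁₁).trace + (B * ρ.toBlocks₂₂).trace := by
  conv_lhs => rw [← fromBlocks_toBlocks ρ, fromBlocks_multiply]
  simp [trace, Fintype.sum_sum_type]

/-- Strong duality for the diamond norm: a difference of channels of diamond norm less than `2 c` is
dominated by `c` times a channel. -/
theorem exists_channel_dominating [Nonempty X] [Nonempty Y] {Φ Ψ : QMap X Y} (hΦ : IsChannel Φ)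
    (hΨ : IsChannel Ψ) {c : ℝ} (h : diamondNorm (Φ - Ψ) < 2 * c) :
    ∃ α : QMap X Y, IsChannel α ∧ IsCP (c • α - (Φ - Ψ)) := by
  have hc : 0 < c := by linarith [diamondNorm_nonneg (Φ - Ψ)]
  set C := choi (Φ - Ψ) with hC
  have hCH : C.IsHermitian := by
    rw [hC, choi_sub]
    exact (isHermitian_choi hΦ.1).sub (isHermitian_choi hΨ.1)
  let K : Set (Op ((Y × X) ⊕ X)) :=
    {k | ∃ Z : Op (Y × X), Z.PosSemidef ∧ k = fromBlocks Z 0 0 (c • 1 - trFst Z)}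
  have hconv : Convex ℝ K := by
    rintro _ ⟨Z, hZ, rfl⟩ _ ⟨Z', hZ', rfl⟩ a b ha hb hab
    refine ⟨a • Z + b • Z', (hZ.smul ha).add (hZ'.smul hb), ?_⟩
    have ht : trFst (a • Z + b • Z') = a • trFst Z + b • trFst Z' := by
      ext x x'
      simp [trFst, Finset.sum_add_distrib, Finset.mul_sum]
    rw [fromBlocks_smul, fromBlocks_smul, fromBlocks_add, ht]
    congr 1
    · simp
    · simp
    · rw [smul_sub, smul_sub, smul_smul, smul_smul]
      have : (c • 1 : Op X) = (a * c) • 1 + (b * c) • 1 := by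
        rw [← add_smul, ← add_mul, hab, one_mul]
      rw [this]
      abel
  have hKH : ∀ k ∈ K, k.IsHermitian := by
    rintro _ ⟨Z, hZ, rfl⟩
    refine IsHermitian.fromBlocks hZ.1 (by simp) ?_
    exact (isHermitian_one.smul (IsSelfAdjoint.all c)).sub (trFst_posSemidef hZ).1
  have hne : K.Nonempty := ⟨_, 0, PosSemidef.zero, rfl⟩
  have hWH : (fromBlocks C 0 0 (0 : Op X)).IsHermitian :=
    IsHermitian.fromBlocks hCH (by simp) isHermitian_zero
  by_cases hex : ∃ k ∈ K, (k - fromBlocks C 0 0 0).PosSemidef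
  · obtain ⟨_, ⟨Z, hZ, rfl⟩, hk⟩ := hex
    have e : fromBlocks Z 0 0 (c • 1 - trFst Z) - fromBlocks C 0 0 0 =
        fromBlocks (Z - C) 0 0 (c • 1 - trFst Z) := by
      rw [sub_eq_add_neg, fromBlocks_neg, fromBlocks_add]
      simp [sub_eq_add_neg]
    rw [e] at hk
    have h1 : (Z - C).PosSemidef := hk.submatrix Sum.inl
    have h2 : (c • 1 - trFst Z).PosSemidef := hk.submatrix Sum.inr
    have hτ := isState_mixed (X := Y)
    set A := c⁻¹ • (Z + mixed Y ⊗ₖ (c • 1 - trFst Z)) with hA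
    have hAP : A.PosSemidef := (hZ.add (hτ.1.kronecker h2)).smul (inv_nonneg.mpr hc.le)
    have hAt : trFst A = 1 := by
      have e1 : trFst A = c⁻¹ • (trFst Z + trFst (mixed Y ⊗ₖ (c • 1 - trFst Z))) := by
        ext x x'
        simp [trFst, hA, Finset.sum_add_distrib, Finset.mul_sum]
      rw [e1, trFst_kronecker, hτ.2, one_smul, add_sub_cancel, smul_smul, inv_mul_cancel₀ hc.ne',
        one_smul]
    refine ⟨ofChoi A, isChannel_of_choi ?_ ?_, isCP_of_posSemidef_choi ?_⟩
    · rwa [choi_ofChoi]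
    · rwa [choi_ofChoi]
    · rw [choi_sub, choi_smul, choi_ofChoi, hA, smul_smul, mul_inv_cancel₀ hc.ne', one_smul,
        ← hC, add_sub_right_comm]
      exact h1.add (hτ.1.kronecker h2)
  · push Not at hex
    exfalso
    obtain ⟨ρ, hρ, hle⟩ := exists_state_of_forall_not_le hconv hne hKH hex hWH
    set w := ρ.toBlocks₁₁ with hw
    set σ := ρ.toBlocks₂₂ with hσ
    have hwP : w.PosSemidef := hρ.1.submatrix Sum.inl
    have hσP : σ.PosSemidef := hρ.1.submatrix Sum.inr
    have hdelta : ∀ Z : Op (Y × X), Z.PosSemidef → ((Z * w).trace).re + c * σ.trace.re -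
        ((trFst Z * σ).trace).re ≤ ((C * w).trace).re := by
      intro Z hZ
      have := hle _ ⟨Z, hZ, rfl⟩
      rw [trace_fromBlocks_mul, trace_fromBlocks_mul, ← hw, ← hσ, zero_mul, trace_zero, add_zero,
        sub_mul, trace_sub, smul_mul_assoc, one_mul, Complex.add_re, Complex.sub_re,
        trace_re_smul] at this
      linarith
    have h1 := hdelta 0 PosSemidef.zero
    have hdom : ((1 : Op Y) ⊗ₖ σ - w).PosSemidef := by
      refine posSemidef_of_trace_mul_nonneg fun Z hZ => ?_
      have hp : ((1 : Op Y) ⊗ₖ σ).PosSemidef := PosSemidef.one.kronecker hσP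
      have a1 := Complex.nonneg_iff.mp (trace_mul_nonneg hZ hp)
      have a2 := Complex.nonneg_iff.mp (trace_mul_nonneg hZ hwP)
      rw [mul_sub, trace_sub, Complex.nonneg_iff, Complex.sub_re, Complex.sub_im, ← a1.2, ← a2.2]
      refine ⟨?_, by simp⟩
      by_contra! hneg
      set g := ((Z * w).trace).re - ((trFst Z * σ).trace).re with hg
      have hg0 : 0 < g := by
        rw [hg, ← trace_mul_one_kronecker]
        linarith
      set r := (((C * w).trace).re - c * σ.trace.re) / g + 1 with hr
      have hr0 : 0 ≤ r := by
        have e0 : trFst (0 : Op (Y × X)) = 0 := by ext; simp [trFst]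
        rw [e0] at h1
        simp only [zero_mul, trace_zero, Complex.zero_re] at h1
        have := div_nonneg (a := ((C * w).trace).re - c * σ.trace.re) (by linarith) hg0.le
        linarith
      have h2 := hdelta (r • Z) (hZ.smul hr0)
      have e1 : trFst (r • Z) = r • trFst Z := by
        ext x x'
        simp [trFst, Finset.mul_sum]
      rw [e1, smul_mul_assoc, smul_mul_assoc, trace_re_smul, trace_re_smul] at h2
      have h3 : r * g = ((C * w).trace).re - c * σ.trace.re + g := by
        rw [hr, add_mul, div_mul_cancel₀ _ hg0.ne', one_mul]
      nlinarith
    have h2 := trace_choi_mul_le hΦ hΨ hwP hσP hdom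
    have e0 : trFst (0 : Op (Y × X)) = 0 := by ext; simp [trFst]
    rw [e0] at h1
    simp only [zero_mul, trace_zero, Complex.zero_re] at h1
    have hσ0 := Complex.nonneg_iff.mp hσP.trace_nonneg
    have hσ1 : σ.trace.re = 0 := by
      by_contra hne
      have := hσ0.1.lt_of_ne (Ne.symm hne)
      nlinarith
    have hσz : σ = 0 := hσP.trace_eq_zero_iff.mp (Complex.ext hσ1 hσ0.2.symm)
    rw [hσz, kronecker_zero, zero_sub] at hdom
    have hw0 : w.trace = 0 := by
      have a1 := hwP.trace_nonneg
      have a2 := hdom.trace_nonneg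
      rw [trace_neg, neg_nonneg] at a2
      exact le_antisymm a2 a1
    have : ρ.trace = w.trace + σ.trace := by
      simp [trace, hw, hσ, toBlocks₁₁, toBlocks₂₂]
    rw [hρ.2, hw0, hσz, trace_zero, add_zero] at this
    exact one_ne_zero this

end Domination

/-! ### Tensor products of maps -/

section Tensor

variable {X Y Z X' Y' X'' Y'' : Type}

theorem ampR_comp_ampL [Finite X] [Finite Y] (Φ : QMap X X') (Ψ : QMap Y Y') :
    ampR Φ Y' ∘ₗ ampL X Ψ = ampL X' Ψ ∘ₗ ampR Φ Y := by
  classical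
  have := Fintype.ofFinite X
  have := Fintype.ofFinite Y
  refine LinearMap.ext fun M => ?_
  ext ⟨a, b⟩ ⟨a', b'⟩
  simp only [LinearMap.comp_apply, ampR_apply, ampL_apply]
  rw [apply_eq_sum Φ, apply_eq_sum Ψ]
  simp only [of_apply]
  simp only [apply_eq_sum Φ (of _), apply_eq_sum Ψ (of _), of_apply, Finset.sum_mul]
  rw [Finset.sum_comm_cycle]
  refine Finset.sum_congr rfl fun y _ => ?_
  rw [Finset.sum_comm_cycle]
  exact Finset.sum_congr rfl fun y' _ => Finset.sum_congr rfl fun x _ =>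
    Finset.sum_congr rfl fun x' _ => mul_right_comm _ _ _

theorem tens_comp [Finite X'] [Finite Y] (Φ : QMap X' X'') (Φ' : QMap X X')
    (Ψ : QMap Y' Y'') (Ψ' : QMap Y Y') :
    tens Φ Ψ ∘ₗ tens Φ' Ψ' = tens (Φ ∘ₗ Φ') (Ψ ∘ₗ Ψ') := by
  have h := ampR_comp_ampL Φ Ψ'
  calc tens Φ Ψ ∘ₗ tens Φ' Ψ' = ampL X'' Ψ ∘ₗ (ampR Φ Y' ∘ₗ ampL X' Ψ') ∘ₗ ampR Φ' Y := rfl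
    _ = _ := by rw [h]; rfl

end Tensor

/-! ### Closure properties of LOCC operations -/

section LOCC

variable {A B A' B' A'' B'' K L : Type} [Fintype A] [Fintype B] [Fintype A'] [Fintype B']
  [Fintype A''] [Fintype B''] [DecidableEq K] [DecidableEq L]

theorem IsLOCCInstrument.isInstrument [Fintype K] {E : K → QMap (A × B) (A' × B')}
    (hE : IsLOCCInstrument E) : IsInstrument E := by
  induction hE with
  | stop_with k Φ Ψ hΦ hΨ =>
    have h := hΦ.tens hΨ
    refine ⟨fun j => ?_, fun M => ?_⟩
    · by_cases hj : j = k
      · subst hj; simpa using h.1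
      · rw [Pi.single_eq_of_ne hj]; exact IsCP.zero
    · rw [Finset.sum_eq_single k]
      · simpa using h.2 M
      · intro j _ hj
        rw [Pi.single_eq_of_ne hj]; simp
      · simp
  | alice F hF E hE ih =>
    refine ⟨fun k => IsCP.sum fun j _ => ((ih j).1 k).comp ((hF.1 j).ampR _), fun M => ?_⟩
    simp only [LinearMap.sum_apply, trace_sum, LinearMap.comp_apply]
    rw [Finset.sum_comm]
    simp only [(ih _).2]
    exact (hF.ampR _).2 M
  | bob F hF E hE ih =>
    refine ⟨fun k => IsCP.sum fun j _ => ((ih j).1 k).comp ((hF.1 j).ampL _), fun M => ?_⟩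
    simp only [LinearMap.sum_apply, trace_sum, LinearMap.comp_apply]
    rw [Finset.sum_comm]
    simp only [(ih _).2]
    exact (hF.ampL _).2 M

theorem IsLOCC.isChannel {Φ : QMap (A × B) (A' × B')} (h : IsLOCC Φ) : IsChannel Φ :=
  isInstrument_const_iff.mp (IsLOCCInstrument.isInstrument h)

theorem IsLOCCInstrument.comp_ampR {E : K → QMap (A' × B) (A'' × B'')}
    (hE : IsLOCCInstrument E) {Φ : QMap A A'} (hΦ : IsChannel Φ) :
    IsLOCCInstrument fun k => E k ∘ₗ ampR Φ B := by
  simpa using IsLOCCInstrument.alice (fun _ : Unit => Φ) (isInstrument_const_iff.mpr hΦ)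
    (fun _ => E) fun _ => hE

theorem IsLOCCInstrument.comp_ampL {E : K → QMap (A × B') (A'' × B'')}
    (hE : IsLOCCInstrument E) {Φ : QMap B B'} (hΦ : IsChannel Φ) :
    IsLOCCInstrument fun k => E k ∘ₗ ampL A Φ := by
  simpa using IsLOCCInstrument.bob (fun _ : Unit => Φ) (isInstrument_const_iff.mpr hΦ)
    (fun _ => E) fun _ => hE

theorem IsLOCCInstrument.comp_tens {E : K → QMap (A' × B') (A'' × B'')}
    (hE : IsLOCCInstrument E) {Φ : QMap A A'} {Ψ : QMap B B'} (hΦ : IsChannel Φ)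
    (hΨ : IsChannel Ψ) : IsLOCCInstrument fun k => E k ∘ₗ tens Φ Ψ :=
  (hE.comp_ampL hΨ).comp_ampR hΦ

theorem IsLOCCInstrument.seq [Fintype K] {E : K → QMap (A × B) (A' × B')}
    (hE : IsLOCCInstrument E) {G : K → L → QMap (A' × B') (A'' × B'')}
    (hG : ∀ k, IsLOCCInstrument (G k)) :
    IsLOCCInstrument fun l => ∑ k, G k l ∘ₗ E k := by
  induction hE with
  | stop_with k Φ Ψ hΦ hΨ =>
    convert (hG k).comp_tens hΦ hΨ using 2 with l
    rw [Finset.sum_eq_single k]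
    · simp
    · intro j _ hj
      rw [Pi.single_eq_of_ne hj, LinearMap.comp_zero]
    · simp
  | alice F hF E hE ih =>
    convert IsLOCCInstrument.alice F hF _ ih using 2 with l
    refine LinearMap.ext fun M => ?_
    simp only [LinearMap.sum_apply, LinearMap.comp_apply, map_sum]
    rw [Finset.sum_comm]
  | bob F hF E hE ih =>
    convert IsLOCCInstrument.bob F hF _ ih using 2 with l
    refine LinearMap.ext fun M => ?_
    simp only [LinearMap.sum_apply, LinearMap.comp_apply, map_sum]
    rw [Finset.sum_comm]

theorem IsLOCC.comp_instrument {E : K → QMap (A' × B') (A'' × B'')} (hE : IsLOCCInstrument E)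
    {Φ : QMap (A × B) (A' × B')} (hΦ : IsLOCC Φ) : IsLOCCInstrument fun k => E k ∘ₗ Φ := by
  simpa using IsLOCCInstrument.seq hΦ (G := fun _ => E) fun _ => hE

theorem IsLOCC.comp {Ψ : QMap (A' × B') (A'' × B'')} (hΨ : IsLOCC Ψ)
    {Φ : QMap (A × B) (A' × B')} (hΦ : IsLOCC Φ) : IsLOCC (Ψ ∘ₗ Φ) :=
  IsLOCC.comp_instrument hΨ hΦ

theorem isLOCC_tens {Φ : QMap A A'} {Ψ : QMap B B'} (hΦ : IsChannel Φ) (hΨ : IsChannel Ψ) :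
    IsLOCC (tens Φ Ψ) := by
  have h : (fun _ : Unit => tens Φ Ψ) = Pi.single () (tens Φ Ψ) := by
    funext u
    simp
  rw [IsLOCC, h]
  exact IsLOCCInstrument.stop_with () Φ Ψ hΦ hΨ

theorem isLOCC_relabel (e : A ≃ A') (f : B ≃ B') :
    IsLOCC (relabel (Equiv.prodCongr e f)) :=
  isLOCC_tens (isChannel_relabel e) (isChannel_relabel f)

theorem IsLOCCInstrument.withAncilla {E : K → QMap (A × B) (A' × B')}
    (hE : IsLOCCInstrument E) (UA UB : Type) [Fintype UA] [Fintype UB] :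
    IsLOCCInstrument fun k => withAncilla UA UB (E k) := by
  induction hE with
  | stop_with k Φ Ψ hΦ hΨ =>
    convert IsLOCCInstrument.stop_with k _ _ (hΦ.ampL UA) (hΨ.ampL UB) using 1
    funext j
    by_cases hj : j = k
    · subst hj
      simp only [Pi.single_eq_same]
      rfl
    · simp only [Pi.single_eq_of_ne hj]
      rfl
  | @alice A B C J _ _ _ _ F hF E hE ih =>
    convert IsLOCCInstrument.alice _ (hF.ampL UA) _ ih using 2 with k
    refine LinearMap.ext fun M => ?_
    ext p q
    simp only [LinearMap.sum_apply, Matrix.sum_apply]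
    change ((∑ j, E j k ∘ₗ ampR (F j) B) _) (p.1.2, p.2.2) (q.1.2, q.2.2) = _
    simp only [LinearMap.sum_apply, Matrix.sum_apply]
    rfl
  | @bob A B C J _ _ _ _ F hF E hE ih =>
    convert IsLOCCInstrument.bob _ (hF.ampL UB) _ ih using 2 with k
    refine LinearMap.ext fun M => ?_
    ext p q
    simp only [LinearMap.sum_apply, Matrix.sum_apply]
    change ((∑ j, E j k ∘ₗ ampL A (F j)) _) (p.1.2, p.2.2) (q.1.2, q.2.2) = _
    simp only [LinearMap.sum_apply, Matrix.sum_apply]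
    rfl

theorem IsLOCC.withAncilla {Φ : QMap (A × B) (A' × B')} (hΦ : IsLOCC Φ) (UA UB : Type)
    [Fintype UA] [Fintype UB] : IsLOCC (withAncilla UA UB Φ) :=
  IsLOCCInstrument.withAncilla hΦ UA UB

end LOCC

/-! ### Superchannels -/

section WithAncilla

variable {A₀ B₀ A₁ B₁ UA UB VA VB WA WB : Type}

theorem withAncilla_sub (Φ Ψ : QMap (A₀ × B₀) (A₁ × B₁)) :
    withAncilla UA UB (Φ - Ψ) = withAncilla UA UB Φ - withAncilla UA UB Ψ := rfl

theorem IsCP.withAncilla {Φ : QMap (A₀ × B₀) (A₁ × B₁)} (hΦ : IsCP Φ) (UA UB : Type)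
    [Finite UA] [Finite UB] : IsCP (withAncilla UA UB Φ) :=
  (isCP_relabel _).comp ((hΦ.ampL (UA × UB)).comp (isCP_relabel _))

theorem IsChannel.withAncilla [Fintype A₀] [Fintype B₀] [Fintype A₁] [Fintype B₁]
    {Φ : QMap (A₀ × B₀) (A₁ × B₁)} (hΦ : IsChannel Φ) (UA UB : Type)
    [Fintype UA] [Fintype UB] : IsChannel (withAncilla UA UB Φ) :=
  (isChannel_relabel _).comp ((hΦ.ampL (UA × UB)).comp (isChannel_relabel _))

/-- Local operations on the ancilla. -/
def onAncilla (A B : Type) (g : QMap UA VA) (h : QMap UB VB) :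
    QMap ((UA × A) × (UB × B)) ((VA × A) × (VB × B)) :=
  tens (ampR g A) (ampR h B)

theorem onAncilla_comp [Finite VA] [Finite UB] [Finite A₀] [Finite B₀] (g : QMap VA WA)
    (g' : QMap UA VA) (h : QMap VB WB) (h' : QMap UB VB) :
    onAncilla A₀ B₀ g h ∘ₗ onAncilla A₀ B₀ g' h' = onAncilla A₀ B₀ (g ∘ₗ g') (h ∘ₗ h') :=
  tens_comp _ _ _ _

theorem onAncilla_id : onAncilla A₀ B₀ (LinearMap.id : QMap UA UA) (LinearMap.id : QMap UB UB) =
    LinearMap.id := rfl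

theorem onAncilla_zero (h : QMap UB VB) :
    onAncilla A₀ B₀ (0 : QMap UA VA) h = 0 := by
  refine LinearMap.ext fun M => ?_
  ext p q
  exact congrFun (congrFun (map_zero h) p.2.1) q.2.1

theorem withAncilla_comp_onAncilla [Finite UA] [Finite UB] [Finite A₀] [Finite B₀]
    (Φ : QMap (A₀ × B₀) (A₁ × B₁)) (g : QMap UA VA) (h : QMap UB VB) :
    withAncilla VA VB Φ ∘ₗ onAncilla A₀ B₀ g h = onAncilla A₁ B₁ g h ∘ₗ withAncilla UA UB Φ := by
  have hdelta := ampR_comp_ampL (tens g h) Φ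
  calc withAncilla VA VB Φ ∘ₗ onAncilla A₀ B₀ g h
      = relabel (Equiv.prodProdProdComm VA VB A₁ B₁) ∘ₗ
          (ampL (VA × VB) Φ ∘ₗ ampR (tens g h) (A₀ × B₀)) ∘ₗ
          relabel (Equiv.prodProdProdComm UA A₀ UB B₀) := rfl
    _ = _ := by rw [← hdelta]; rfl

end WithAncilla

namespace LOCCSuperchannel

variable {A₀ B₀ A₁ B₁ A₀' B₀' A₁' B₁' S₀ T₀ S₁ T₁ : Type}
  [Fintype A₀] [Fintype B₀] [Fintype A₁] [Fintype B₁]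
  [Fintype A₀'] [Fintype B₀'] [Fintype A₁'] [Fintype B₁']
  [Fintype S₀] [Fintype T₀] [Fintype S₁] [Fintype T₁]

attribute [instance] LOCCSuperchannel.fintypeUA LOCCSuperchannel.fintypeUB

/-- Composition of superchannels. -/
def comp (Θ : LOCCSuperchannel A₀' B₀' A₁' B₁' S₀ T₀ S₁ T₁)
    (Λ : LOCCSuperchannel A₀ B₀ A₁ B₁ A₀' B₀' A₁' B₁') :
    LOCCSuperchannel A₀ B₀ A₁ B₁ S₀ T₀ S₁ T₁ where
  UA := Θ.UA × Λ.UA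
  UB := Θ.UB × Λ.UB
  pre := relabel (Equiv.prodCongr (Equiv.prodAssoc Θ.UA Λ.UA A₀).symm
    (Equiv.prodAssoc Θ.UB Λ.UB B₀).symm) ∘ₗ withAncilla Θ.UA Θ.UB Λ.pre ∘ₗ Θ.pre
  post := Θ.post ∘ₗ withAncilla Θ.UA Θ.UB Λ.post ∘ₗ
    relabel (Equiv.prodCongr (Equiv.prodAssoc Θ.UA Λ.UA A₁) (Equiv.prodAssoc Θ.UB Λ.UB B₁))
  pre_locc := (isLOCC_relabel _ _).comp ((Λ.pre_locc.withAncilla _ _).comp Θ.pre_locc)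
  post_locc := Θ.post_locc.comp ((Λ.post_locc.withAncilla _ _).comp (isLOCC_relabel _ _))

theorem comp_apply (Θ : LOCCSuperchannel A₀' B₀' A₁' B₁' S₀ T₀ S₁ T₁)
    (Λ : LOCCSuperchannel A₀ B₀ A₁ B₁ A₀' B₀' A₁' B₁') (Φ : QMap (A₀ × B₀) (A₁ × B₁)) :
    (Θ.comp Λ).apply Φ = Θ.apply (Λ.apply Φ) := rfl

theorem apply_sub (Θ : LOCCSuperchannel A₀ B₀ A₁ B₁ S₀ T₀ S₁ T₁)
    (Φ Ψ : QMap (A₀ × B₀) (A₁ × B₁)) : Θ.apply (Φ - Ψ) = Θ.apply Φ - Θ.apply Ψ := by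
  simp only [apply, withAncilla_sub, LinearMap.sub_comp, LinearMap.comp_sub]

theorem apply_smul (Θ : LOCCSuperchannel A₀ B₀ A₁ B₁ S₀ T₀ S₁ T₁) (c : ℝ)
    (Φ : QMap (A₀ × B₀) (A₁ × B₁)) : Θ.apply (c • Φ) = c • Θ.apply Φ := by
  refine LinearMap.ext fun M => ?_
  exact LinearMap.map_smul_of_tower Θ.post c _

theorem isCP_apply (Θ : LOCCSuperchannel A₀ B₀ A₁ B₁ S₀ T₀ S₁ T₁)
    {Φ : QMap (A₀ × B₀) (A₁ × B₁)} (hΦ : IsCP Φ) : IsCP (Θ.apply Φ) :=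
  Θ.post_locc.isChannel.1.comp ((hΦ.withAncilla _ _).comp Θ.pre_locc.isChannel.1)

theorem isChannel_apply (Θ : LOCCSuperchannel A₀ B₀ A₁ B₁ S₀ T₀ S₁ T₁)
    {Φ : QMap (A₀ × B₀) (A₁ × B₁)} (hΦ : IsChannel Φ) : IsChannel (Θ.apply Φ) :=
  Θ.post_locc.isChannel.comp ((hΦ.withAncilla _ _).comp Θ.pre_locc.isChannel)

instance [Nonempty A₀] [Nonempty B₀] [Nonempty S₁] [Nonempty T₁] :
    Nonempty (LOCCSuperchannel A₀ B₀ A₁ B₁ S₀ T₀ S₁ T₁) := by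
  classical
  exact ⟨{
    UA := Unit
    UB := Unit
    pre := tens (replaceMap (mixed _)) (replaceMap (mixed _))
    post := tens (replaceMap (mixed _)) (replaceMap (mixed _))
    pre_locc := isLOCC_tens (isChannel_replaceMap isState_mixed) (isChannel_replaceMap isState_mixed)
    post_locc := isLOCC_tens (isChannel_replaceMap isState_mixed)
      (isChannel_replaceMap isState_mixed) }⟩

/-- The superchannel that does nothing. -/
def one (A₀ B₀ A₁ B₁ : Type) [Fintype A₀] [Fintype B₀] [Fintype A₁] [Fintype B₁] :
    LOCCSuperchannel A₀ B₀ A₁ B₁ A₀ B₀ A₁ B₁ where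
  UA := Unit
  UB := Unit
  pre := relabel (Equiv.prodCongr (Equiv.punitProd A₀).symm (Equiv.punitProd B₀).symm)
  post := relabel (Equiv.prodCongr (Equiv.punitProd A₁) (Equiv.punitProd B₁))
  pre_locc := isLOCC_relabel _ _
  post_locc := isLOCC_relabel _ _

/-- The pairing with a superchannel evaluates its action on a map. -/
theorem pairing_tensorChoi_toMap [DecidableEq A₀] [DecidableEq B₀]
    (Θ : LOCCSuperchannel A₀ B₀ A₁ B₁ S₀ T₀ S₁ T₁) (Φ : QMap (A₀ × B₀) (A₁ × B₁))
    (ρ : Op ((S₀ × T₀) × (S₁ × T₁))) :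
    pairing (tensorChoi ρ (choi Φ)) Θ.toMap = pairing ρ (Θ.apply Φ) := by
  rw [pairing_eq_re_sum, pairing_eq_re_sum]
  simp only [Fintype.sum_prod_type (α₁ := S₁ × T₁) (α₂ := A₀ × B₀)]
  congr 1
  refine Finset.sum_congr rfl fun q _ => ?_
  rw [Finset.sum_comm]
  refine Finset.sum_congr rfl fun q' _ => ?_
  set R := Θ.pre (of fun p p' => ρ (p, q) (p', q')) with hR
  let N : (A₀ × B₀) → (A₀ × B₀) → Op ((Θ.UA × A₁) × (Θ.UB × B₁)) := fun i i' => of fun v v' =>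
    R ((v.1.1, i.1), (v.2.1, i.2)) ((v'.1.1, i'.1), (v'.2.1, i'.2)) *
      choi Φ ((v.1.2, v.2.2), i) ((v'.1.2, v'.2.2), i')
  have hN : withAncilla Θ.UA Θ.UB Φ R = ∑ i, ∑ i', N i i' := by
    ext v v'
    rw [Matrix.sum_apply]
    simp only [Matrix.sum_apply]
    exact apply_eq_sum_choi Φ (of fun i i' => R ((v.1.1, i.1), (v.2.1, i.2))
      ((v'.1.1, i'.1), (v'.2.1, i'.2))) (v.1.2, v.2.2) (v'.1.2, v'.2.2)
  have h1 : (Θ.apply Φ) (of fun p p' => ρ (p, q) (p', q')) q q' =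
      ∑ i, ∑ i', Θ.post (N i i') q q' := by
    change Θ.post (withAncilla Θ.UA Θ.UB Φ R) q q' = _
    rw [hN]
    simp only [map_sum, Matrix.sum_apply]
  rw [h1]
  refine Finset.sum_congr rfl fun i _ => Finset.sum_congr rfl fun i' _ => ?_
  change Θ.post (of fun v v' => Θ.pre (of fun p p' => ρ (p, q) (p', q') *
    choi Φ ((v.1.2, v.2.2), i) ((v'.1.2, v'.2.2), i')) ((v.1.1, i.1), (v.2.1, i.2))
      ((v'.1.1, i'.1), (v'.2.1, i'.2))) q q' = _
  have h3 : (of fun v v' => Θ.pre (of fun p p' => ρ (p, q) (p', q') *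
      choi Φ ((v.1.2, v.2.2), i) ((v'.1.2, v'.2.2), i')) ((v.1.1, i.1), (v.2.1, i.2))
      ((v'.1.1, i'.1), (v'.2.1, i'.2))) = N i i' := by
    ext v v'
    have h2 : (of fun p p' => ρ (p, q) (p', q') *
        choi Φ ((v.1.2, v.2.2), i) ((v'.1.2, v'.2.2), i')) =
        choi Φ ((v.1.2, v.2.2), i) ((v'.1.2, v'.2.2), i') • of fun p p' => ρ (p, q) (p', q') := by
      ext p p'
      exact mul_comm _ _
    rw [of_apply, h2, map_smul]
    exact mul_comm _ _
  rw [h3]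

end LOCCSuperchannel

/-! ### Mixtures of superchannels -/

section Sigma

variable {J : Type} [Fintype J] [DecidableEq J] (U : J → Type) [∀ j, Fintype (U j)]
  [∀ j, DecidableEq (U j)]

/-- The inclusion of a summand into a direct sum of systems. -/
def sigmaIncl (j : J) : Matrix (Σ j, U j) (U j) ℂ := of fun p u => if p = ⟨j, u⟩ then 1 else 0

theorem sigmaIncl_conjTranspose_mul_self (j : J) : (sigmaIncl U j)ᴴ * sigmaIncl U j = 1 := by
  ext u u'
  simp [sigmaIncl, mul_apply, one_apply, apply_ite, eq_comm]

theorem sigmaIncl_conjTranspose_mul_of_ne {i j : J} (h : i ≠ j) :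
    (sigmaIncl U i)ᴴ * sigmaIncl U j = 0 := by
  ext u u'
  simp [sigmaIncl, mul_apply, apply_ite, h.symm]

/-- The orthogonal projection onto a summand of a direct sum of systems. -/
def sigmaProj (j : J) : Op (Σ j, U j) := sigmaIncl U j * (sigmaIncl U j)ᴴ

theorem sum_sigmaProj : ∑ j, sigmaProj U j = 1 := by
  ext p q
  have h : (∑ j, sigmaProj U j) p q = ∑ r : Σ j, U j, (if p = r then 1 else 0) *
      star (if q = r then (1 : ℂ) else 0) := by
    rw [Matrix.sum_apply, Fintype.sum_sigma]
    rfl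
  rw [h]
  simp [one_apply, apply_ite, eq_comm]

theorem sigmaProj_conjTranspose (j : J) : (sigmaProj U j)ᴴ = sigmaProj U j := by
  simp [sigmaProj]

theorem sigmaProj_mul_self (j : J) : sigmaProj U j * sigmaProj U j = sigmaProj U j := by
  rw [sigmaProj, Matrix.mul_assoc, ← Matrix.mul_assoc _ (sigmaIncl U j),
    sigmaIncl_conjTranspose_mul_self, Matrix.one_mul]

theorem sigmaProj_mul_sigmaIncl (j : J) : sigmaProj U j * sigmaIncl U j = sigmaIncl U j := by
  rw [sigmaProj, Matrix.mul_assoc, sigmaIncl_conjTranspose_mul_self, Matrix.mul_one]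

theorem sigmaProj_mul_sigmaIncl_of_ne {i j : J} (h : i ≠ j) :
    sigmaProj U i * sigmaIncl U j = 0 := by
  rw [sigmaProj, Matrix.mul_assoc, sigmaIncl_conjTranspose_mul_of_ne U h, Matrix.mul_zero]

theorem isInstrument_sigmaProj : IsInstrument fun j => conjMap (sigmaProj U j) := by
  refine ⟨fun j => isCP_conjMap _, fun M => ?_⟩
  simp only [conjMap_apply, sigmaProj_conjTranspose]
  have h : ∀ j, (sigmaProj U j * M * sigmaProj U j).trace = (sigmaProj U j * M).trace := fun j => by
    rw [trace_mul_cycle, sigmaProj_mul_self]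
  simp only [h]
  rw [← trace_sum, ← Finset.sum_mul, sum_sigmaProj, one_mul]

/-- The compression to a summand of a direct sum of systems, completed to a channel. -/
def sigmaCompress (j : J) : QMap (Σ j, U j) (U j) :=
  conjMap (sigmaIncl U j)ᴴ + replaceMap (mixed (U j)) ∘ₗ conjMap (1 - sigmaProj U j)

theorem isChannel_sigmaCompress (j : J) [Nonempty (U j)] : IsChannel (sigmaCompress U j) := by
  refine ⟨(isCP_conjMap _).add ((isChannel_replaceMap isState_mixed).1.comp (isCP_conjMap _)),
    fun M => ?_⟩
  rw [sigmaCompress, LinearMap.add_apply, trace_add, LinearMap.comp_apply,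
    (isChannel_replaceMap isState_mixed).2, conjMap_apply, conjMap_apply, trace_mul_cycle,
    trace_mul_cycle (1 - _), conjTranspose_conjTranspose, ← trace_add, ← add_mul,
    conjTranspose_sub, conjTranspose_one, sigmaProj_conjTranspose, mul_sub, sub_mul, sub_mul,
    sigmaProj_mul_self, ← sigmaProj]
  simp

theorem conjMap_comp {X Y Z : Type} [Fintype X] [Fintype Y] (V : Matrix Z Y ℂ)
    (W : Matrix Y X ℂ) : conjMap V ∘ₗ conjMap W = conjMap (V * W) := by
  refine LinearMap.ext fun M => ?_
  simp only [LinearMap.comp_apply, conjMap_apply, conjTranspose_mul, Matrix.mul_assoc]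

theorem conjMap_zero {X Y : Type} [Fintype X] : conjMap (0 : Matrix Y X ℂ) = 0 := by
  refine LinearMap.ext fun M => ?_
  simp [conjMap_apply]

theorem conjMap_one {X : Type} [Fintype X] [DecidableEq X] :
    conjMap (1 : Op X) = LinearMap.id := by
  refine LinearMap.ext fun M => ?_
  simp [conjMap_apply]

theorem sigmaCompress_comp_sigmaIncl (j : J) :
    sigmaCompress U j ∘ₗ conjMap (sigmaIncl U j) = LinearMap.id := by
  rw [sigmaCompress, LinearMap.add_comp, LinearMap.comp_assoc, conjMap_comp, conjMap_comp,
    sigmaIncl_conjTranspose_mul_self, Matrix.sub_mul, Matrix.one_mul, sigmaProj_mul_sigmaIncl,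
    sub_self, conjMap_zero, conjMap_one, LinearMap.comp_zero, add_zero]

end Sigma

theorem IsChannel.nonempty {X Y : Type} [Fintype X] [Fintype Y] [Nonempty X] {Φ : QMap X Y}
    (hΦ : IsChannel Φ) : Nonempty Y := by
  classical
  by_contra h
  rw [not_nonempty_iff] at h
  have h1 := hΦ.2 (mixed X)
  rw [isState_mixed.2] at h1
  simp [trace] at h1

section Mixture

variable {A₀ B₀ A₁ B₁ S₀ T₀ S₁ T₁ : Type}
  [Fintype A₀] [Fintype B₀] [Fintype A₁] [Fintype B₁]
  [Fintype S₀] [Fintype T₀] [Fintype S₁] [Fintype T₁] [Nonempty S₀] [Nonempty T₀]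

/-- LOCC superchannels are closed under mixtures: a coin is stored in the block structure of
the ancilla. -/
theorem LOCCSuperchannel.exists_mixture {J : Type} [Fintype J]
    (Θ : J → LOCCSuperchannel A₀ B₀ A₁ B₁ S₀ T₀ S₁ T₁) {p : J → ℝ} (hp : ∀ j, 0 ≤ p j)
    (hp1 : ∑ j, p j = 1) :
    ∃ Ω : LOCCSuperchannel A₀ B₀ A₁ B₁ S₀ T₀ S₁ T₁,
      ∀ Φ, Ω.apply Φ = ∑ j, p j • (Θ j).apply Φ := by
  classical
  let U : J → Type := fun j => (Θ j).UA
  let V : J → Type := fun j => (Θ j).UB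
  have hUV : ∀ j, Nonempty (U j) ∧ Nonempty (V j) := fun j => by
    obtain ⟨⟨⟨u, -⟩, ⟨v, -⟩⟩⟩ := (Θ j).pre_locc.isChannel.nonempty
    exact ⟨⟨u⟩, ⟨v⟩⟩
  have hU := fun j => (hUV j).1
  have hV := fun j => (hUV j).2
  let F : J → QMap S₀ S₀ := fun j => p j • LinearMap.id
  have hF : IsInstrument F := by
    refine ⟨fun j => IsCP.id.smul (hp j), fun M => ?_⟩
    simp only [F, LinearMap.smul_apply, LinearMap.id_apply, trace_smul]
    rw [← Finset.sum_smul, hp1, one_smul]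
  let embed : ∀ j, QMap ((U j × A₀) × (V j × B₀)) (((Σ j, U j) × A₀) × ((Σ j, V j) × B₀)) :=
    fun j => onAncilla A₀ B₀ (conjMap (sigmaIncl U j)) (conjMap (sigmaIncl V j))
  have hembed : ∀ j, IsLOCC (embed j) := fun j =>
    isLOCC_tens ((isChannel_conjMap (sigmaIncl_conjTranspose_mul_self U j)).ampR A₀)
      ((isChannel_conjMap (sigmaIncl_conjTranspose_mul_self V j)).ampR B₀)
  let compress : ∀ j, QMap (((Σ j, U j) × A₁) × ((Σ j, V j) × B₁)) ((U j × A₁) × (V j × B₁)) :=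
    fun j => onAncilla A₁ B₁ (sigmaCompress U j) (sigmaCompress V j)
  have hcompress : ∀ j, IsLOCC (compress j) := fun j =>
    isLOCC_tens ((isChannel_sigmaCompress U j).ampR A₁) ((isChannel_sigmaCompress V j).ampR B₁)
  let meas : ∀ j, QMap (((Σ j, U j) × A₁) × ((Σ j, V j) × B₁))
      (((Σ j, U j) × A₁) × ((Σ j, V j) × B₁)) :=
    fun j => onAncilla A₁ B₁ (conjMap (sigmaProj U j)) LinearMap.id
  let Ω : LOCCSuperchannel A₀ B₀ A₁ B₁ S₀ T₀ S₁ T₁ :=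
    { UA := Σ j, U j
      UB := Σ j, V j
      pre := ∑ j, (embed j ∘ₗ (Θ j).pre) ∘ₗ ampR (F j) T₀
      post := ∑ j, ((Θ j).post ∘ₗ compress j) ∘ₗ meas j
      pre_locc := IsLOCCInstrument.alice F hF (fun j _ => embed j ∘ₗ (Θ j).pre)
        fun j => (hembed j).comp (Θ j).pre_locc
      post_locc := IsLOCCInstrument.alice _ ((isInstrument_sigmaProj U).ampR A₁)
        (fun j _ => (Θ j).post ∘ₗ compress j) fun j => (Θ j).post_locc.comp (hcompress j) }
  refine ⟨Ω, fun Φ => ?_⟩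
  have hcross : ∀ i j, compress i ∘ₗ meas i ∘ₗ withAncilla (Σ j, U j) (Σ j, V j) Φ ∘ₗ embed j =
      (compress i ∘ₗ meas i ∘ₗ onAncilla A₁ B₁ (conjMap (sigmaIncl U j))
        (conjMap (sigmaIncl V j))) ∘ₗ withAncilla (U j) (V j) Φ := by
    intro i j
    rw [withAncilla_comp_onAncilla]
    rfl
  have hne : ∀ i j, i ≠ j →
      compress i ∘ₗ meas i ∘ₗ withAncilla (Σ j, U j) (Σ j, V j) Φ ∘ₗ embed j = 0 := by
    intro i j hij
    rw [hcross, onAncilla_comp, conjMap_comp, sigmaProj_mul_sigmaIncl_of_ne U hij, conjMap_zero,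
      onAncilla_zero, LinearMap.comp_zero, LinearMap.zero_comp]
  have heq : ∀ j, compress j ∘ₗ meas j ∘ₗ withAncilla (Σ j, U j) (Σ j, V j) Φ ∘ₗ embed j =
      withAncilla (U j) (V j) Φ := by
    intro j
    rw [hcross, onAncilla_comp, onAncilla_comp, conjMap_comp, sigmaProj_mul_sigmaIncl,
      sigmaCompress_comp_sigmaIncl, LinearMap.id_comp, sigmaCompress_comp_sigmaIncl, onAncilla_id,
      LinearMap.id_comp]
  have hFj : ∀ j M, ampR (F j) T₀ M = p j • M := fun j M => rfl
  refine LinearMap.ext fun M => ?_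
  have h1 : Ω.apply Φ M = ∑ i, ∑ j, (Θ i).post ((compress i ∘ₗ meas i ∘ₗ
      withAncilla (Σ j, U j) (Σ j, V j) Φ ∘ₗ embed j) ((Θ j).pre (p j • M))) := by
    change (∑ i, ((Θ i).post ∘ₗ compress i) ∘ₗ meas i) (withAncilla (Σ j, U j) (Σ j, V j) Φ
      ((∑ j, (embed j ∘ₗ (Θ j).pre) ∘ₗ ampR (F j) T₀) M)) = _
    simp only [LinearMap.sum_apply, map_sum, LinearMap.comp_apply, hFj]
    exact Finset.sum_comm
  rw [h1, LinearMap.sum_apply]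
  refine Finset.sum_congr rfl fun i _ => ?_
  rw [Finset.sum_eq_single i]
  · rw [heq]
    exact LinearMap.map_smul_of_tower ((Θ i).apply Φ) (p i) M
  · intro j _ hj
    rw [hne i j hj.symm, LinearMap.zero_apply, map_zero]
  · simp

end Mixture

/-! ### Conversion distance and domination -/

theorem traceNorm_neg {X : Type} [Fintype X] [DecidableEq X] (M : Op X) :
    traceNorm (-M) = traceNorm M := by
  have h : ∀ (P Q : Op X) (hP : P.IsHermitian) (hQ : Q.IsHermitian), P = Q →
      ∑ i, √(hP.eigenvalues i) = ∑ i, √(hQ.eigenvalues i) := by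
    rintro P _ hP hQ rfl
    rfl
  exact h _ _ _ _ (by rw [conjTranspose_neg, neg_mul_neg])

theorem diamondNorm_sub_comm {X Y : Type} [Fintype X] [Fintype Y] [DecidableEq X] [DecidableEq Y]
    (Φ Ψ : QMap X Y) : diamondNorm (Φ - Ψ) = diamondNorm (Ψ - Φ) := by
  have h : ∀ ρ, traceNorm (ampR (Φ - Ψ) X ρ) = traceNorm (ampR (Ψ - Φ) X ρ) := fun ρ => by
    rw [← traceNorm_neg]
    congr 1
    change -(ampR Φ X ρ - ampR Ψ X ρ) = ampR Ψ X ρ - ampR Φ X ρ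
    abel
  simp only [diamondNorm, h]

theorem le_add_mul_of_forall_lt {a b x s : ℝ} (h : ∀ c, s < c → x ≤ a + c * b) :
    x ≤ a + s * b := by
  refine le_of_forall_pos_le_add fun η hη => ?_
  have hb : 0 < |b| + 1 := by positivity
  have h1 := h (s + η / (|b| + 1)) (by linarith [div_pos hη hb])
  have h2 : η / (|b| + 1) * b ≤ η := by
    rw [div_mul_eq_mul_div, div_le_iff₀ hb]
    nlinarith [le_abs_self b]
  linarith

section Dominated

variable {A₀ B₀ A₁ B₁ S₀ T₀ S₁ T₁ : Type}
  [Fintype A₀] [Fintype B₀] [Fintype A₁] [Fintype B₁]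
  [Fintype S₀] [Fintype T₀] [Fintype S₁] [Fintype T₁]

/-- `Φ₂` is, up to `c` times a channel, below a channel obtained from `Φ₁` by an LOCC
superchannel. -/
def IsDominated (Φ₁ : QMap (A₀ × B₀) (A₁ × B₁)) (Φ₂ : QMap (S₀ × T₀) (S₁ × T₁)) (c : ℝ) : Prop :=
  ∃ (Λ : LOCCSuperchannel A₀ B₀ A₁ B₁ S₀ T₀ S₁ T₁) (α : QMap (S₀ × T₀) (S₁ × T₁)),
    IsChannel α ∧ IsCP (c • α - (Φ₂ - Λ.apply Φ₁))

variable {Φ₁ : QMap (A₀ × B₀) (A₁ × B₁)} {Φ₂ : QMap (S₀ × T₀) (S₁ × T₁)}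

theorem deltaLOCC_le_iff [Nonempty A₀] [Nonempty B₀] [Nonempty S₀] [Nonempty T₀] [Nonempty S₁]
    [Nonempty T₁] [DecidableEq S₀] [DecidableEq T₀] [DecidableEq S₁] [DecidableEq T₁]
    (hΦ₁ : IsChannel Φ₁) (hΦ₂ : IsChannel Φ₂) {ε : ℝ} (hε : 0 ≤ ε) :
    deltaLOCC Φ₁ Φ₂ ≤ ε ↔ ∀ c, ε / 2 < c → IsDominated Φ₁ Φ₂ c := by
  constructor
  · intro h c hc
    have h1 : deltaLOCC Φ₁ Φ₂ < 2 * c := by linarith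
    obtain ⟨Λ, hΛ⟩ := exists_lt_of_ciInf_lt h1
    rw [diamondNorm_sub_comm] at hΛ
    obtain ⟨α, hα, h2⟩ := exists_channel_dominating hΦ₂ (Λ.isChannel_apply hΦ₁) hΛ
    exact ⟨Λ, α, hα, h2⟩
  · intro h
    refine le_of_forall_pos_le_add fun η hη => ?_
    obtain ⟨Λ, α, hα, h2⟩ := h ((ε + η) / 2) (by linarith)
    have h3 := diamondNorm_sub_le hΦ₂ (Λ.isChannel_apply hΦ₁) hα (by linarith) h2
    rw [diamondNorm_sub_comm] at h3
    refine (ciInf_le ⟨0, ?_⟩ Λ).trans (h3.trans_eq (by ring))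
    rintro _ ⟨Λ, rfl⟩
    exact diamondNorm_nonneg _

theorem exists_state_of_not_isDominated [Nonempty A₀] [Nonempty B₀] [Nonempty S₀] [Nonempty T₀]
    [Nonempty S₁] [Nonempty T₁] (hΦ₁ : IsChannel Φ₁) (hΦ₂ : IsChannel Φ₂) {c : ℝ}
    (h : ¬ IsDominated Φ₁ Φ₂ c) :
    ∃ ρ : Op ((S₀ × T₀) × (S₁ × T₁)), IsState ρ ∧
      ∀ (Λ : LOCCSuperchannel A₀ B₀ A₁ B₁ S₀ T₀ S₁ T₁) (α : QMap (S₀ × T₀) (S₁ × T₁)),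
        IsChannel α → pairing ρ (Λ.apply Φ₁) + c * pairing ρ α ≤ pairing ρ Φ₂ := by
  classical
  let K : Set (Op ((S₁ × T₁) × (S₀ × T₀))) :=
    {k | ∃ (Λ : LOCCSuperchannel A₀ B₀ A₁ B₁ S₀ T₀ S₁ T₁) (α : QMap (S₀ × T₀) (S₁ × T₁)),
      IsChannel α ∧ k = choi (Λ.apply Φ₁ + c • α)}
  have hconv : Convex ℝ K := by
    rintro _ ⟨Λ, α, hα, rfl⟩ _ ⟨Λ', α', hα', rfl⟩ a b ha hb hab
    obtain ⟨Ω, hΩ⟩ := LOCCSuperchannel.exists_mixture (J := Bool) (fun j => if j then Λ else Λ')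
      (p := fun j => if j then a else b) (by intro j; cases j <;> simpa) (by simpa using hab)
    refine ⟨Ω, a • α + b • α', ⟨(hα.1.smul ha).add (hα'.1.smul hb), fun M => ?_⟩, ?_⟩
    · simp only [LinearMap.add_apply, LinearMap.smul_apply, trace_add, trace_smul, hα.2, hα'.2]
      rw [← add_smul, hab, one_smul]
    · rw [hΩ, ← choi_smul, ← choi_smul, ← choi_add]
      congr 1
      simp only [Fintype.sum_bool, if_true, Bool.false_eq_true, if_false, smul_add, smul_smul,
        mul_comm c]
      abel
  have hKH : ∀ k ∈ K, k.IsHermitian := by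
    rintro _ ⟨Λ, α, hα, rfl⟩
    rw [choi_add, choi_smul]
    exact (isHermitian_choi (Λ.isCP_apply hΦ₁.1)).add
      ((isHermitian_choi hα.1).smul (IsSelfAdjoint.all c))
  have hne : K.Nonempty :=
    ⟨_, Classical.arbitrary _, replaceMap (mixed _), isChannel_replaceMap isState_mixed, rfl⟩
  obtain ⟨ρ, hρ, hle⟩ := exists_state_of_forall_not_le hconv hne hKH (W := choi Φ₂) (by
    rintro _ ⟨Λ, α, hα, rfl⟩ hk
    refine h ⟨Λ, α, hα, isCP_of_posSemidef_choi ?_⟩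
    rw [← choi_sub] at hk
    convert hk using 2
    abel) (isHermitian_choi hΦ₂.1)
  refine ⟨pairOp ρ, isState_pairOp hρ, fun Λ α hα => ?_⟩
  have h1 := hle _ ⟨Λ, α, hα, rfl⟩
  rw [← pairing_smul_right, ← pairing_add_right, pairing_eq_trace, pairing_eq_trace, pairOp_pairOp]
  exact h1

end Dominated

section Norm

variable {A₀ B₀ A₁ B₁ S₀ T₀ S₁ T₁ : Type}
  [Fintype A₀] [Fintype B₀] [Fintype A₁] [Fintype B₁] [DecidableEq A₀] [DecidableEq B₀]
  [Fintype S₀] [Fintype T₀] [Fintype S₁] [Fintype T₁]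
  {ρ : Op ((S₀ × T₀) × (S₁ × T₁))} {Φ : QMap (A₀ × B₀) (A₁ × B₁)}

theorem le_norm2LOCC (hρ : IsState ρ) (hΦ : IsChannel Φ)
    (Θ : LOCCSuperchannel A₀ B₀ A₁ B₁ S₀ T₀ S₁ T₁) :
    pairing ρ (Θ.apply Φ) ≤ norm2LOCC (tensorChoi ρ (choi Φ)) := by
  rw [← Θ.pairing_tensorChoi_toMap]
  refine le_ciSup (f := fun Θ : LOCCSuperchannel A₀ B₀ A₁ B₁ S₀ T₀ S₁ T₁ =>
    pairing (tensorChoi ρ (choi Φ)) Θ.toMap) ⟨Fintype.card (S₀ × T₀), ?_⟩ Θ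
  rintro _ ⟨Θ, rfl⟩
  simp only [Θ.pairing_tensorChoi_toMap]
  exact pairing_le_card hρ (Θ.isChannel_apply hΦ)

theorem norm2LOCC_le [Nonempty A₀] [Nonempty B₀] [Nonempty S₁] [Nonempty T₁] {c : ℝ}
    (h : ∀ Θ : LOCCSuperchannel A₀ B₀ A₁ B₁ S₀ T₀ S₁ T₁, pairing ρ (Θ.apply Φ) ≤ c) :
    norm2LOCC (tensorChoi ρ (choi Φ)) ≤ c :=
  ciSup_le fun Θ => (Θ.pairing_tensorChoi_toMap Φ ρ).le.trans (h Θ)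

theorem norm2LOCC_le_of_isDominated [Nonempty S₁] [Nonempty T₁] {A₀' B₀' A₁' B₁' : Type}
    [Fintype A₀'] [Fintype B₀'] [Fintype A₁'] [Fintype B₁'] [DecidableEq A₀'] [DecidableEq B₀']
    [Nonempty A₀'] [Nonempty B₀']
    (hρ : IsState ρ) (hΦ : IsChannel Φ) {Ψ : QMap (A₀' × B₀') (A₁' × B₁')} {c : ℝ} (hc : 0 ≤ c)
    (h : IsDominated Φ Ψ c) :
    norm2LOCC (tensorChoi ρ (choi Ψ)) ≤
      norm2LOCC (tensorChoi ρ (choi Φ)) + c * dualDiamondNorm ρ := by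
  obtain ⟨Λ, α, hα, hCP⟩ := h
  refine norm2LOCC_le fun Θ => ?_
  have h1 := Θ.isCP_apply hCP
  rw [Θ.apply_sub, Θ.apply_sub, Θ.apply_smul, ← Θ.comp_apply] at h1
  have h2 := pairing_nonneg hρ.1 h1
  rw [pairing_sub_right, pairing_sub_right, pairing_smul_right] at h2
  have h3 := le_norm2LOCC hρ hΦ (Θ.comp Λ)
  have h4 := mul_le_mul_of_nonneg_left (le_dualDiamondNorm hρ (Θ.isChannel_apply hα)) hc
  linarith

end Norm

/-! ### Measurements and guessing games -/

section Measurements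

variable {X Y K : Type} [Fintype X] [Fintype Y] [DecidableEq X] [DecidableEq Y] [Fintype K]

theorem exists_povm_of_functionals (L : K → Op X →ₗ[ℂ] ℂ)
    (hpos : ∀ k M, M.PosSemidef → 0 ≤ L k M) (hsum : ∀ M, ∑ k, L k M = M.trace) :
    ∃ N : K → Op X, IsPOVM N ∧ ∀ k M, L k M = (M * N k).trace := by
  choose N hN using fun k => exists_trace_mul_eq (L k)
  refine ⟨N, ⟨fun k => posSemidef_of_trace_mul_nonneg fun P hP => ?_, ?_⟩, hN⟩
  · rw [← hN]
    exact hpos k P hP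
  · refine Matrix.ext_iff_trace_mul_left.mpr fun M => ?_
    rw [mul_one, Finset.mul_sum, trace_sum, ← hsum M]
    simp only [hN]

theorem IsPOVM.exists_comp {Γ : QMap X Y} (hΓ : IsChannel Γ) {M : K → Op Y} (hM : IsPOVM M) :
    ∃ N : K → Op X, IsPOVM N ∧ ∀ k A, (Γ A * M k).trace = (A * N k).trace := by
  let L : K → Op X →ₗ[ℂ] ℂ := fun k =>
    traceLinearMap Y ℂ ℂ ∘ₗ LinearMap.mulRight ℂ (M k) ∘ₗ Γ
  exact exists_povm_of_functionals L
    (fun k A hA => trace_mul_nonneg (hΓ.1.posSemidef_apply hA) (hM.1 k)) fun A => by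
      change ∑ k, (Γ A * M k).trace = _
      rw [← trace_sum, ← Finset.mul_sum, hM.2, mul_one, hΓ.2]

theorem IsInstrument.exists_povm {E : K → QMap X Y} (hE : IsInstrument E) :
    ∃ N : K → Op X, IsPOVM N ∧ ∀ k A, (E k A).trace = (A * N k).trace :=
  exists_povm_of_functionals (fun k => traceLinearMap Y ℂ ℂ ∘ₗ E k)
    (fun k _ hA => ((hE.1 k).posSemidef_apply hA).trace_nonneg) hE.2

theorem Ensemble.sum_le_one {n : ℕ} (𝓔 : Ensemble X n) {M : Fin n → Op X} (hM : IsPOVM M) :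
    ∑ i, 𝓔.prob i * ((𝓔.state i * M i).trace).re ≤ 1 := by
  rw [← 𝓔.prob_sum]
  refine Finset.sum_le_sum fun i _ => mul_le_of_le_one_right (𝓔.prob_nonneg i) ?_
  have h1 : (1 - M i).PosSemidef := by
    rw [← hM.2, ← Finset.add_sum_erase _ _ (Finset.mem_univ i), add_sub_cancel_left]
    exact posSemidef_sum _ fun j _ => hM.1 j
  have h2 := Complex.nonneg_iff.mp (trace_mul_nonneg (𝓔.state_isState i).1 h1)
  rw [mul_sub, mul_one, trace_sub, (𝓔.state_isState i).2] at h2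
  simpa using h2.1

theorem Ensemble.le_psucc {n : ℕ} (𝓔 : Ensemble X n) {M : Fin n → Op X} (hM : IsPOVM M) :
    ∑ i, 𝓔.prob i * ((𝓔.state i * M i).trace).re ≤ 𝓔.psucc := by
  refine le_csSup ⟨1, ?_⟩ ⟨M, hM, rfl⟩
  rintro _ ⟨N, hN, rfl⟩
  exact 𝓔.sum_le_one hN

theorem Ensemble.psucc_le {n : ℕ} (𝓔 : Ensemble X n) {c : ℝ} (hc : 0 ≤ c)
    (h : ∀ M : Fin n → Op X, IsPOVM M →
      ∑ i, 𝓔.prob i * ((𝓔.state i * M i).trace).re ≤ c) : 𝓔.psucc ≤ c := by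
  refine Real.sSup_le ?_ hc
  rintro _ ⟨N, hN, rfl⟩
  exact h N hN

end Measurements

namespace LOCCStrategy

attribute [instance] LOCCStrategy.fintypeUA LOCCStrategy.fintypeUB
  LOCCStrategy.decidableEqUA LOCCStrategy.decidableEqUB

variable {A₀ B₀ A₁ B₁ S₀ T₀ S₁ T₁ : Type}
  [Fintype A₀] [Fintype B₀] [Fintype A₁] [Fintype B₁]
  [Fintype S₀] [Fintype T₀] [Fintype S₁] [Fintype T₁]
  [DecidableEq A₁] [DecidableEq B₁] [DecidableEq S₁] [DecidableEq T₁] {n : ℕ}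
  (σ : LOCCStrategy A₀ B₀ A₁ B₁ S₀ T₀ S₁ T₁ n)

/-- The map that prepares the state to be measured. -/
def outMap (Φ : QMap (A₀ × B₀) (A₁ × B₁)) :
    QMap ((S₀ × T₀) × (S₁ × T₁)) (((σ.UA × A₁) × S₁) × ((σ.UB × B₁) × T₁)) :=
  relabel (Equiv.prodProdProdComm (σ.UA × A₁) (σ.UB × B₁) S₁ T₁) ∘ₗ
    ampR (withAncilla σ.UA σ.UB Φ ∘ₗ σ.pre) (S₁ × T₁)

theorem value_eq (Φ : QMap (A₀ × B₀) (A₁ × B₁)) (𝓔 : Ensemble ((S₀ × T₀) × (S₁ × T₁)) n) :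
    σ.value Φ 𝓔 = ∑ i, 𝓔.prob i * ((σ.outMap Φ (𝓔.state i) * σ.meas i).trace).re := rfl

theorem isCP_outMap {Φ : QMap (A₀ × B₀) (A₁ × B₁)} (hΦ : IsCP Φ) : IsCP (σ.outMap Φ) :=
  (isCP_relabel _).comp (((hΦ.withAncilla _ _).comp σ.pre_locc.isChannel.1).ampR _)

theorem isChannel_outMap {Φ : QMap (A₀ × B₀) (A₁ × B₁)} (hΦ : IsChannel Φ) :
    IsChannel (σ.outMap Φ) :=
  (isChannel_relabel _).comp (((hΦ.withAncilla _ _).comp σ.pre_locc.isChannel).ampR _)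

theorem value_sub (Φ Ψ : QMap (A₀ × B₀) (A₁ × B₁)) (𝓔 : Ensemble ((S₀ × T₀) × (S₁ × T₁)) n) :
    σ.value (Φ - Ψ) 𝓔 = σ.value Φ 𝓔 - σ.value Ψ 𝓔 := by
  have h : ∀ i, σ.outMap (Φ - Ψ) (𝓔.state i) = σ.outMap Φ (𝓔.state i) - σ.outMap Ψ (𝓔.state i) :=
    fun i => rfl
  simp only [value_eq, h, sub_mul, trace_sub, Complex.sub_re, mul_sub, Finset.sum_sub_distrib]

theorem value_smul (c : ℝ) (Φ : QMap (A₀ × B₀) (A₁ × B₁))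
    (𝓔 : Ensemble ((S₀ × T₀) × (S₁ × T₁)) n) : σ.value (c • Φ) 𝓔 = c * σ.value Φ 𝓔 := by
  have h : ∀ i, σ.outMap (c • Φ) (𝓔.state i) = c • σ.outMap Φ (𝓔.state i) := fun i => rfl
  simp only [value_eq, h, smul_mul_assoc, trace_re_smul, Finset.mul_sum, mul_left_comm]

theorem value_nonneg {Φ : QMap (A₀ × B₀) (A₁ × B₁)} (hΦ : IsCP Φ)
    (𝓔 : Ensemble ((S₀ × T₀) × (S₁ × T₁)) n) : 0 ≤ σ.value Φ 𝓔 :=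
  Finset.sum_nonneg fun i _ => mul_nonneg (𝓔.prob_nonneg i)
    (Complex.nonneg_iff.mp (trace_mul_nonneg
      ((σ.isCP_outMap hΦ).posSemidef_apply (𝓔.state_isState i).1) (σ.meas_locc.1.1 i))).1

theorem value_le_psucc [DecidableEq S₀] [DecidableEq T₀] {Φ : QMap (A₀ × B₀) (A₁ × B₁)}
    (hΦ : IsChannel Φ) (𝓔 : Ensemble ((S₀ × T₀) × (S₁ × T₁)) n) : σ.value Φ 𝓔 ≤ 𝓔.psucc := by
  obtain ⟨N, hN, h⟩ := IsPOVM.exists_comp (σ.isChannel_outMap hΦ) σ.meas_locc.1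
  simp only [value_eq, h]
  exact 𝓔.le_psucc hN

theorem value_le_psuccLOCC {Φ : QMap (A₀ × B₀) (A₁ × B₁)}
    (hΦ : IsChannel Φ) (𝓔 : Ensemble ((S₀ × T₀) × (S₁ × T₁)) n) :
    σ.value Φ 𝓔 ≤ psuccLOCC Φ 𝓔 := by
  classical
  refine le_ciSup (f := fun σ : LOCCStrategy A₀ B₀ A₁ B₁ S₀ T₀ S₁ T₁ n => σ.value Φ 𝓔)
    ⟨𝓔.psucc, ?_⟩ σ
  rintro _ ⟨σ, rfl⟩
  exact σ.value_le_psucc hΦ 𝓔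

theorem exists_value_eq_value_apply {A₀' B₀' A₁' B₁' : Type}
    [Fintype A₀'] [Fintype B₀'] [Fintype A₁'] [Fintype B₁'] [DecidableEq A₁'] [DecidableEq B₁']
    (Λ : LOCCSuperchannel A₀' B₀' A₁' B₁' A₀ B₀ A₁ B₁) :
    ∃ τ : LOCCStrategy A₀' B₀' A₁' B₁' S₀ T₀ S₁ T₁ n,
      ∀ Φ 𝓔, τ.value Φ 𝓔 = σ.value (Λ.apply Φ) 𝓔 := by
  classical
  obtain ⟨-, E, hE, hEM⟩ := σ.meas_locc
  let e (U V A S : Type) : ((U × V) × A) × S ≃ (U × S) × (V × A) :=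
    { toFun := fun p => ((p.1.1.1, p.2), (p.1.1.2, p.1.2))
      invFun := fun p => (((p.1.1, p.2.1), p.2.2), p.1.2)
      left_inv := fun _ => rfl
      right_inv := fun _ => rfl }
  let f (U S A : Type) : (U × S) × A ≃ (U × A) × S :=
    { toFun := fun p => ((p.1.1, p.2), p.1.2)
      invFun := fun p => ((p.1.1, p.2), p.1.2)
      left_inv := fun _ => rfl
      right_inv := fun _ => rfl }
  let G : QMap ((((σ.UA × Λ.UA) × A₁') × S₁) × (((σ.UB × Λ.UB) × B₁') × T₁))
      (((σ.UA × A₁) × S₁) × ((σ.UB × B₁) × T₁)) :=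
    relabel (Equiv.prodCongr (f σ.UA S₁ A₁) (f σ.UB T₁ B₁)) ∘ₗ
      withAncilla (σ.UA × S₁) (σ.UB × T₁) Λ.post ∘ₗ
        relabel (Equiv.prodCongr (e σ.UA Λ.UA A₁' S₁) (e σ.UB Λ.UB B₁' T₁))
  have hG : IsLOCC G := (isLOCC_relabel _ _).comp ((Λ.post_locc.withAncilla _ _).comp
    (isLOCC_relabel _ _))
  have hEG : IsLOCCInstrument fun k => E k ∘ₗ G := IsLOCC.comp_instrument hE hG
  obtain ⟨N, hN, hEN⟩ := hEG.isInstrument.exists_povm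
  refine ⟨{
    UA := σ.UA × Λ.UA
    UB := σ.UB × Λ.UB
    pre := relabel (Equiv.prodCongr (Equiv.prodAssoc σ.UA Λ.UA A₀').symm
      (Equiv.prodAssoc σ.UB Λ.UB B₀').symm) ∘ₗ withAncilla σ.UA σ.UB Λ.pre ∘ₗ σ.pre
    meas := N
    pre_locc := (isLOCC_relabel _ _).comp ((Λ.pre_locc.withAncilla _ _).comp σ.pre_locc)
    meas_locc := ⟨hN, _, hEG, hEN⟩ }, fun Φ 𝓔 => ?_⟩
  rw [value_eq, value_eq]
  refine Finset.sum_congr rfl fun i _ => ?_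
  rw [← hEN, ← hEM]
  rfl

end LOCCStrategy

theorem psuccLOCC_le_of_isDominated {A₀ B₀ A₁ B₁ A₀' B₀' A₁' B₁' S₀ T₀ S₁ T₁ : Type}
    [Fintype A₀] [Fintype B₀] [Fintype A₁] [Fintype B₁] [DecidableEq A₁] [DecidableEq B₁]
    [Fintype A₀'] [Fintype B₀'] [Fintype A₁'] [Fintype B₁'] [DecidableEq A₁'] [DecidableEq B₁']
    [Fintype S₀] [Fintype T₀] [Fintype S₁] [Fintype T₁]
    [DecidableEq S₀] [DecidableEq T₀] [DecidableEq S₁] [DecidableEq T₁]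
    {Φ : QMap (A₀ × B₀) (A₁ × B₁)} (hΦ : IsChannel Φ) {Ψ : QMap (A₀' × B₀') (A₁' × B₁')}
    {c : ℝ} (hc : 0 ≤ c) (h : IsDominated Φ Ψ c) {n : ℕ}
    (𝓔 : Ensemble ((S₀ × T₀) × (S₁ × T₁)) n) :
    psuccLOCC Ψ 𝓔 ≤ psuccLOCC Φ 𝓔 + c * 𝓔.psucc := by
  obtain ⟨Λ, α, hα, hCP⟩ := h
  refine Real.iSup_le (fun σ => ?_) (add_nonneg (Real.iSup_nonneg fun σ => σ.value_nonneg hΦ.1 𝓔)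
    (mul_nonneg hc (Real.sSup_nonneg ?_)))
  · obtain ⟨τ, hτ⟩ := σ.exists_value_eq_value_apply Λ
    have h1 := σ.value_nonneg hCP 𝓔
    rw [σ.value_sub, σ.value_sub, σ.value_smul, ← hτ] at h1
    have h2 := τ.value_le_psuccLOCC hΦ 𝓔
    have h3 := mul_le_mul_of_nonneg_left (σ.value_le_psucc hα 𝓔) hc
    linarith
  · rintro _ ⟨M, hM, rfl⟩
    exact Finset.sum_nonneg fun i _ => mul_nonneg (𝓔.prob_nonneg i)
      (Complex.nonneg_iff.mp (trace_mul_nonneg (𝓔.state_isState i).1 (hM.1 i))).1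

/-! ### Unitary operator bases -/

/-- A family of unitaries that resolves the identity on operators. -/
structure IsUnitaryBasis {Y K : Type} [Fintype Y] [DecidableEq Y] [Fintype K]
    (W : K → Op Y) : Prop where
  unitary : ∀ k, (W k)ᴴ * W k = 1
  sum_mul_star : ∀ a b c d, ∑ k, W k a b * star (W k c d) =
    if a = c ∧ b = d then (Fintype.card Y : ℂ) else 0
  card : Fintype.card K = Fintype.card Y ^ 2

/-- Shift and phase operators for an identification of the basis with a finite abelian group. -/
def weyl {Y G : Type} [AddCommGroup G] [DecidableEq G] (e : Y ≃ G) (k : G × AddChar G ℂ) : Op Y :=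
  of fun a b => if e a = e b + k.1 then k.2 (e b) else 0

theorem isUnitaryBasis_weyl {Y G : Type} [Fintype Y] [DecidableEq Y] [AddCommGroup G] [Fintype G]
    [DecidableEq G] (e : Y ≃ G) : IsUnitaryBasis (weyl e) := by
  have hchar : ∀ (χ : AddChar G ℂ) x y, χ x * star (χ y) = χ (x - y) := fun χ x y => by
    rw [sub_eq_add_neg, AddChar.map_add_eq_mul, AddChar.map_neg_eq_conj]
    rfl
  have hcard : Fintype.card Y = Fintype.card G := Fintype.card_congr e
  refine ⟨fun k => ?_, fun a b c d => ?_, ?_⟩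
  · ext b b'
    rw [mul_apply, Fintype.sum_eq_single (e.symm (e b + k.1))]
    · by_cases h : b = b'
      · subst h
        have h1 := hchar k.2 (e b) (e b)
        rw [sub_self, AddChar.map_zero_eq_one, mul_comm] at h1
        simpa [weyl] using h1
      · simp [weyl, h]
    · intro a ha
      have : e a ≠ e b + k.1 := fun h => ha (by rw [← h, e.symm_apply_apply])
      simp [weyl, this]
  · rw [Fintype.sum_prod_type, Finset.sum_eq_single (e a - e b)]
    · have h : ∀ χ : AddChar G ℂ, weyl e (e a - e b, χ) a b * star (weyl e (e a - e b, χ) c d) =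
          if e c = e d + (e a - e b) then χ (e b - e d) else 0 := fun χ => by
        rw [← hchar]
        by_cases h : e c = e d + (e a - e b) <;> simp [weyl, h]
      simp only [h]
      split_ifs with h1 h2 h2
      · rw [AddChar.sum_apply_eq_ite, if_pos (by rw [h2.2, sub_self]), hcard]
      · rw [AddChar.sum_apply_eq_ite, if_neg]
        intro h3
        rw [sub_eq_zero] at h3
        refine h2 ⟨?_, e.injective h3⟩
        rw [h3] at h1
        exact e.injective (by rw [h1]; abel)
      · exact absurd (by rw [h2.1, h2.2]; abel) h1
      · simp
    · intro g _ hg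
      refine Finset.sum_eq_zero fun χ _ => ?_
      have : e a ≠ e b + g := fun h => hg (by rw [h]; abel)
      simp [weyl, this]
    · simp
  · rw [Fintype.card_prod, AddChar.card_eq, hcard, sq]

theorem exists_isUnitaryBasis (Y : Type) [Fintype Y] [DecidableEq Y] [Nonempty Y] :
    ∃ (K : Type) (_ : Fintype K) (W : K → Op Y), IsUnitaryBasis W := by
  have : NeZero (Fintype.card Y) := ⟨Fintype.card_ne_zero⟩
  exact ⟨_, inferInstance, _, isUnitaryBasis_weyl
    ((Fintype.equivFin Y).trans (ZMod.finEquiv (Fintype.card Y)).toEquiv)⟩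

theorem IsUnitaryBasis.kronecker {X Y K L J : Type} [Fintype X] [DecidableEq X] [Fintype Y]
    [DecidableEq Y] [Fintype K] [Fintype L] [Fintype J] {V : K → Op X} {W : L → Op Y}
    (hV : IsUnitaryBasis V) (hW : IsUnitaryBasis W) (e : J ≃ K × L) :
    IsUnitaryBasis fun j => V (e j).1 ⊗ₖ W (e j).2 := by
  refine ⟨fun j => ?_, fun a b c d => ?_, ?_⟩
  · rw [conjTranspose_kronecker, ← mul_kronecker_mul, hV.unitary, hW.unitary, one_kronecker_one]
  · rw [e.sum_comp fun p => (V p.1 ⊗ₖ W p.2) a b * star ((V p.1 ⊗ₖ W p.2) c d),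
      Fintype.sum_prod_type]
    have h : ∀ k l, (V k ⊗ₖ W l) a b * star ((V k ⊗ₖ W l) c d) =
        V k a.1 b.1 * star (V k c.1 d.1) * (W l a.2 b.2 * star (W l c.2 d.2)) := fun k l => by
      simp only [kroneckerMap_apply, star_mul']
      ring
    simp only [h, ← Finset.mul_sum, ← Finset.sum_mul, hV.sum_mul_star, hW.sum_mul_star,
      Prod.ext_iff, Fintype.card_prod]
    by_cases h1 : a.1 = c.1 <;> by_cases h2 : a.2 = c.2 <;> by_cases h3 : b.1 = d.1 <;>
      by_cases h4 : b.2 = d.2 <;> simp [h1, h2, h3, h4]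
  · rw [Fintype.card_congr e, Fintype.card_prod, Fintype.card_prod, hV.card, hW.card]
    ring

/-! ### Decoding of a measurement by teleportation -/

section Decode

variable {X Y V : Type} [Fintype X] [Fintype Y] [Fintype V]

theorem pairing_conjMap_comp (ρ : Op (X × Y)) (W : Op Y) (γ : QMap X Y) :
    pairing ρ (conjMap Wᵀ ∘ₗ γ) = pairing (ampL X (conjMap W) ρ) γ := by
  rw [pairing_eq_re_sum, pairing_eq_re_sum]
  congr 1
  have h : ∀ z z', (of fun x x' => ampL X (conjMap W) ρ (x, z) (x', z')) =
      ∑ y', ∑ y, (W z y * star (W z' y')) • of fun x x' => ρ (x, y) (x', y') := by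
    intro z z'
    ext x x'
    simp only [ampL_apply, conjMap_apply, mul_apply, of_apply, conjTranspose_apply,
      Matrix.sum_apply, Matrix.smul_apply, smul_eq_mul, Finset.sum_mul]
    exact Finset.sum_congr rfl fun _ _ => Finset.sum_congr rfl fun _ _ => by ring
  simp only [h, map_sum, map_smul, Matrix.sum_apply, Matrix.smul_apply, smul_eq_mul,
    LinearMap.comp_apply, conjMap_apply, mul_apply, conjTranspose_apply, transpose_apply,
    Finset.sum_mul]
  rw [Finset.sum_comm_cycle]
  conv_rhs => rw [Finset.sum_comm]
  refine Finset.sum_congr rfl fun z' _ => ?_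
  rw [Finset.sum_comm_cycle]
  refine Finset.sum_congr rfl fun z _ => ?_
  rw [Finset.sum_comm]
  exact Finset.sum_congr rfl fun y' _ => Finset.sum_congr rfl fun y _ => mul_right_comm _ _ _

theorem trace_pairOp_mul_pairOp (M N : Op (X × Y)) :
    (pairOp M * pairOp N).trace = (N * M).trace := by
  have h : pairOp M * pairOp N = relabel (Equiv.prodComm X Y) (N * M)ᵀ := by
    rw [transpose_mul]
    exact submatrix_mul_equiv Mᵀ Nᵀ _ (Equiv.prodComm Y X) _
  rw [h, trace_relabel, trace_transpose]

theorem pairing_sum_right {J : Type} [Fintype J] (ρ : Op (X × Y)) (φ : J → QMap X Y) :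
    pairing ρ (∑ j, φ j) = ∑ j, pairing ρ (φ j) :=
  map_sum (AddMonoidHom.mk' (pairing ρ) (pairing_add_right ρ)) φ Finset.univ

/-- The outcome `M` of a measurement on `V × Y`, with a maximally entangled state prepared
on `Y × Y`, followed by the correction `Wᵀ`. -/
def decodeStep (W : Op Y) (M : Op (V × Y)) : QMap V Y := conjMap Wᵀ ∘ₗ ofChoi (pairOp M)

theorem pairing_decodeStep_comp (ρ : Op (X × Y)) (W : Op Y) (M : Op (V × Y)) (β : QMap X V) :
    pairing ρ (decodeStep W M ∘ₗ β) =
      ((ampR β Y (ampL X (conjMap W) ρ) * M).trace).re := by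
  classical
  rw [decodeStep, LinearMap.comp_assoc, pairing_conjMap_comp]
  have h : pairing (ampL X (conjMap W) ρ) (ofChoi (pairOp M) ∘ₗ β) =
    pairing (ampR β Y (ampL X (conjMap W) ρ)) (ofChoi (pairOp M)) := rfl
  rw [h, pairing_eq_trace, choi_ofChoi, trace_pairOp_mul_pairOp]

variable {K : Type} [Fintype K]

/-- The channel from `V` to `Y` obtained from a measurement on `V × Y` by teleportation. -/
def decode (W : K → Op Y) (M : K → Op (V × Y)) : QMap V Y :=
  (Fintype.card Y : ℝ)⁻¹ • ∑ k, decodeStep (W k) (M k)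

theorem pairing_decode_comp (ρ : Op (X × Y)) (W : K → Op Y) (M : K → Op (V × Y)) (β : QMap X V) :
    pairing ρ (decode W M ∘ₗ β) = (Fintype.card Y : ℝ)⁻¹ *
      ∑ k, ((ampR β Y (ampL X (conjMap (W k)) ρ) * M k).trace).re := by
  simp only [← pairing_decodeStep_comp]
  rw [decode, LinearMap.smul_comp, pairing_smul_right]
  have h : (∑ k, decodeStep (W k) (M k)) ∘ₗ β = ∑ k, decodeStep (W k) (M k) ∘ₗ β := by
    refine LinearMap.ext fun A => ?_
    simp [LinearMap.sum_apply]
  rw [h, pairing_sum_right]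

theorem isChannel_conjMap_transpose [DecidableEq Y] {W : Op Y} (hW : Wᴴ * W = 1) :
    IsChannel (conjMap Wᵀ) :=
  isChannel_conjMap (by
    have h : Wᵀᴴ = Wᴴᵀ := rfl
    rw [h, ← transpose_mul, mul_eq_one_comm.mp hW, transpose_one])

theorem isChannel_decode [DecidableEq Y] [DecidableEq V] [Nonempty Y] {W : K → Op Y}
    (hW : ∀ k, (W k)ᴴ * W k = 1)
    {M : K → Op (V × Y)} (hM : IsPOVM M) : IsChannel (decode W M) := by
  have hWT := fun k => isChannel_conjMap_transpose (hW k)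
  refine ⟨(IsCP.sum fun k _ => (hWT k).1.comp (isCP_of_posSemidef_choi ?_)).smul (by positivity),
    fun A => ?_⟩
  · rw [choi_ofChoi]
    exact (hM.1 k).transpose.submatrix _
  · simp only [decode, decodeStep, LinearMap.smul_apply, trace_smul, LinearMap.sum_apply, trace_sum,
      LinearMap.comp_apply, (hWT _).2]
    have h : ∀ k, (ofChoi (pairOp (M k)) A).trace = ∑ v, ∑ v', A v v' * ∑ y, M k (v', y) (v, y) := by
      intro k
      rw [trace_apply_eq_sum_choi, choi_ofChoi]
      rfl
    have h1 : ∀ v v', ∑ k, ∑ y, M k (v', y) (v, y) = if v' = v then (Fintype.card Y : ℂ) else 0 := by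
      intro v v'
      rw [Finset.sum_comm]
      simp only [← Matrix.sum_apply, hM.2, one_apply, Prod.ext_iff, and_true]
      split_ifs <;> simp
    simp only [h]
    rw [Finset.sum_comm_cycle, Finset.sum_comm_cycle, Finset.sum_comm]
    simp only [← Finset.mul_sum, h1]
    have hd : (Fintype.card Y : ℂ) ≠ 0 := by simp
    simp only [mul_ite, mul_zero, Finset.sum_ite_eq, Finset.mem_univ, if_true,
      ← Finset.sum_mul, Complex.real_smul]
    push_cast
    rw [mul_comm, mul_assoc, mul_inv_cancel₀ hd, mul_one]
    rfl

end Decode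

/-! ### Product measurements -/

section ProductMeasurement

variable {A B A' B' K L J : Type} [Fintype A] [Fintype B] [DecidableEq A] [DecidableEq B]

/-- The map `X ↦ tr(X M)`. -/
def measMap (M : Op A) : QMap A Unit := ofChoi (Mᵀ.submatrix Prod.snd Prod.snd)

theorem measMap_apply (M X : Op A) (u v : Unit) : measMap M X u v = (X * M).trace := rfl

theorem trace_unit_prod_unit (M : Op (Unit × Unit)) : M.trace = M ((), ()) ((), ()) := by
  simp only [trace, diag_apply, Fintype.sum_prod_type, Finset.univ_unique, Finset.sum_singleton]

theorem IsPOVM.isInstrument_measMap [Fintype K] {M : K → Op A} (hM : IsPOVM M) :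
    IsInstrument fun k => measMap (M k) := by
  refine ⟨fun k => isCP_of_posSemidef_choi ?_, fun X => ?_⟩
  · have h : choi (measMap (M k)) = (M k)ᵀ.submatrix Prod.snd Prod.snd := choi_ofChoi _
    rw [h]
    exact (hM.1 k).transpose.submatrix _
  · have h : ∀ k, (measMap (M k) X).trace = (X * M k).trace := fun k => by
      rw [← measMap_apply _ _ () ()]
      simp [trace]
    simp only [h]
    rw [← trace_sum, ← Finset.mul_sum, hM.2, mul_one]

theorem trace_tens_measMap (M : Op A) (N : Op B) (X : Op (A × B)) :
    (tens (measMap M) (measMap N) X).trace = (X * (M ⊗ₖ N)).trace := by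
  have h : (tens (measMap M) (measMap N) X).trace =
      measMap N (of fun b b' => measMap M (of fun a a' => X (a, b) (a', b')) () ()) () () := trace_unit_prod_unit _
  rw [h]
  simp only [measMap_apply, trace, diag_apply, mul_apply, of_apply, Fintype.sum_prod_type,
    kroneckerMap_apply, Finset.sum_mul]
  rw [Finset.sum_comm_cycle]
  refine Finset.sum_congr rfl fun a _ => Finset.sum_congr rfl fun b _ => ?_
  rw [Finset.sum_comm]
  simp only [mul_assoc]

theorem isLOCCMeasurement_kronecker [Fintype K] [Fintype L] [Fintype J] [DecidableEq J]
    {M : K → Op A} (hM : IsPOVM M) {N : L → Op B} (hN : IsPOVM N) (e : J ≃ K × L) :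
    IsLOCCMeasurement fun j => M (e j).1 ⊗ₖ N (e j).2 := by
  have hE : IsLOCCInstrument fun j => tens (measMap (M (e j).1)) (measMap (N (e j).2)) := by
    convert IsLOCCInstrument.alice _ hM.isInstrument_measMap _ fun k =>
      IsLOCCInstrument.bob _ hN.isInstrument_measMap _ fun l =>
        IsLOCCInstrument.stop_with (e.symm (k, l)) _ _ (isChannel_id (X := Unit))
          (isChannel_id (X := Unit)) using 2 with j
    rw [Finset.sum_eq_single (e j).1, Finset.sum_eq_single (e j).2]
    · simp
      rfl
    · intro l _ hl
      rw [Pi.single_eq_of_ne, LinearMap.zero_comp]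
      intro h
      exact hl (by rw [h]; simp)
    · simp
    · intro k _ hk
      rw [Finset.sum_eq_zero, LinearMap.zero_comp]
      intro l _
      rw [Pi.single_eq_of_ne, LinearMap.zero_comp]
      intro h
      exact hk (by rw [h]; simp)
    · simp
  obtain ⟨P, hP, hEP⟩ := hE.isInstrument.exists_povm
  have h : P = fun j => M (e j).1 ⊗ₖ N (e j).2 := funext fun j =>
    Matrix.ext_iff_trace_mul_left.mpr fun X => by rw [← hEP, trace_tens_measMap]
  exact h ▸ ⟨hP, _, hE, hEP⟩

end ProductMeasurement

/-! ### Decoding by local operations -/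

section LocalDecode

variable {X Y Z V : Type} [Fintype X] [Fintype Y] [DecidableEq Y] [Fintype V]
  [DecidableEq V]

theorem tens_conjMap {X' Y' : Type} (V : Matrix X' X ℂ) (W : Matrix Y' Y ℂ) :
    tens (conjMap V) (conjMap W) = conjMap (V ⊗ₖ W) := by
  refine LinearMap.ext fun M => ?_
  ext ⟨a, b⟩ ⟨a', b'⟩
  change conjMap W (of fun y y' => conjMap V (of fun x x' => M (x, y) (x', y')) a a') b b' = _
  simp only [conjMap_apply, mul_apply, of_apply, conjTranspose_apply, kroneckerMap_apply,
    Finset.sum_mul, Finset.mul_sum, Fintype.sum_prod_type, star_mul']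
  rw [Finset.sum_comm_cycle]
  refine Finset.sum_congr rfl fun x' _ => ?_
  refine Finset.sum_congr rfl fun y' _ => ?_
  rw [Finset.sum_comm]
  exact Finset.sum_congr rfl fun _ _ => Finset.sum_congr rfl fun _ _ => by ring

/-- The map that appends a maximally entangled state on `Y × Y`. -/
def appendMaxEnt (V Y : Type) [Fintype V] [Fintype Y] [DecidableEq V] [DecidableEq Y] :
    QMap V (Y × (V × Y)) :=
  (Fintype.card Y : ℝ)⁻¹ • conjMap (of fun p v => if p.1 = p.2.2 ∧ p.2.1 = v then 1 else 0)

theorem appendMaxEnt_apply (M : Op V) (p q : Y × (V × Y)) : appendMaxEnt V Y M p q =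
    (Fintype.card Y : ℂ)⁻¹ * if p.1 = p.2.2 ∧ q.1 = q.2.2 then M p.2.1 q.2.1 else 0 := by
  simp only [appendMaxEnt, LinearMap.smul_apply, Matrix.smul_apply, conjMap_apply, mul_apply,
    of_apply, conjTranspose_apply]
  by_cases h1 : p.1 = p.2.2 <;> by_cases h2 : q.1 = q.2.2 <;> simp [h1, h2, apply_ite]

theorem isChannel_appendMaxEnt [Nonempty Y] : IsChannel (appendMaxEnt V Y) := by
  refine ⟨(isCP_conjMap _).smul (by positivity), fun M => ?_⟩
  have hd : (Fintype.card Y : ℂ) ≠ 0 := by simp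
  simp [trace, appendMaxEnt_apply, Fintype.sum_prod_type, Finset.sum_ite_eq, ← Finset.mul_sum, hd]

variable {A B VA VB K : Type} [Fintype A] [Fintype B] [DecidableEq A] [DecidableEq B]
  [Fintype VA] [Fintype VB] [DecidableEq VA] [DecidableEq VB] [Fintype K] [DecidableEq K]

theorem decodeStep_kronecker (WA : Op A) (WB : Op B) {M : Op ((VA × A) × (VB × B))}
    {E : QMap ((VA × A) × (VB × B)) (Unit × Unit)} (hE : ∀ X, (E X).trace = (X * M).trace) :
    tens (conjMap WAᵀ ∘ₗ relabel (Equiv.prodPUnit A)) (conjMap WBᵀ ∘ₗ relabel (Equiv.prodPUnit B)) ∘ₗ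
      withAncilla A B E ∘ₗ tens (appendMaxEnt VA A) (appendMaxEnt VB B) =
    (Fintype.card (A × B) : ℝ)⁻¹ • decodeStep (WA ⊗ₖ WB)
      (relabel (Equiv.prodProdProdComm VA VB A B).symm M) := by
  have h : tens (relabel (Equiv.prodPUnit A)) (relabel (Equiv.prodPUnit B)) ∘ₗ
      withAncilla A B E ∘ₗ tens (appendMaxEnt VA A) (appendMaxEnt VB B) =
      (Fintype.card (A × B) : ℝ)⁻¹ •
        ofChoi (pairOp (relabel (Equiv.prodProdProdComm VA VB A B).symm M)) := by
    refine LinearMap.ext fun X => ?_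
    ext ⟨a, b⟩ ⟨a', b'⟩
    have h1 : (tens (relabel (Equiv.prodPUnit A)) (relabel (Equiv.prodPUnit B)) ∘ₗ
        withAncilla A B E ∘ₗ tens (appendMaxEnt VA A) (appendMaxEnt VB B)) X (a, b) (a', b') =
        (E (of fun p q => tens (appendMaxEnt VA A) (appendMaxEnt VB B) X
          ((a, p.1), (b, p.2)) ((a', q.1), (b', q.2)))).trace := (trace_unit_prod_unit _).symm
    have h2 : ∀ p q, tens (appendMaxEnt VA A) (appendMaxEnt VB B) X p q =
        (Fintype.card (A × B) : ℂ)⁻¹ * if (p.1.1, p.2.1) = (p.1.2.2, p.2.2.2) ∧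
          (q.1.1, q.2.1) = (q.1.2.2, q.2.2.2) then X (p.1.2.1, p.2.2.1) (q.1.2.1, q.2.2.1)
            else 0 := by
      intro p q
      change appendMaxEnt VB B (of fun y y' => appendMaxEnt VA A
        (of fun x x' => X (x, y) (x', y')) p.1 q.1) p.2 q.2 = _
      simp only [appendMaxEnt_apply, of_apply, Prod.mk.injEq, Fintype.card_prod]
      by_cases h1 : p.1.1 = p.1.2.2 <;> by_cases h2 : p.2.1 = p.2.2.2 <;>
        by_cases h3 : q.1.1 = q.1.2.2 <;> by_cases h4 : q.2.1 = q.2.2.2 <;>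
        simp [h1, h2, h3, h4, mul_assoc, mul_comm, mul_left_comm]
    rw [h1, hE]
    simp only [trace, diag_apply, mul_apply, of_apply, h2]
    rw [LinearMap.smul_apply, Matrix.smul_apply, ofChoi_apply]
    simp only [Fintype.sum_prod_type, ite_and, Prod.mk.injEq, mul_ite, ite_mul, mul_zero, zero_mul,
      Finset.sum_ite_eq, Finset.sum_ite_irrel, Finset.sum_const_zero, Finset.mem_univ, if_true,
      Complex.real_smul, Finset.mul_sum]
    push_cast
    simp only [mul_assoc]
    rfl
  rw [← tens_comp, tens_conjMap, LinearMap.comp_assoc, h, decodeStep, LinearMap.comp_smul]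
  rfl

theorem isLOCC_decode [Nonempty A] [Nonempty B] {WA : K → Op A} {WB : K → Op B}
    (hWA : ∀ k, (WA k)ᴴ * WA k = 1) (hWB : ∀ k, (WB k)ᴴ * WB k = 1)
    {M : K → Op ((VA × A) × (VB × B))} (hM : IsLOCCMeasurement M) :
    IsLOCC (decode (fun k => WA k ⊗ₖ WB k)
      fun k => relabel (Equiv.prodProdProdComm VA VB A B).symm (M k)) := by
  obtain ⟨-, E, hE, hEM⟩ := hM
  have h1 : IsLOCCInstrument fun k => withAncilla A B (E k) ∘ₗ
      tens (appendMaxEnt VA A) (appendMaxEnt VB B) :=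
    IsLOCC.comp_instrument (hE.withAncilla A B)
      (isLOCC_tens isChannel_appendMaxEnt isChannel_appendMaxEnt)
  have h2 := IsLOCCInstrument.seq h1
    (G := fun k (_ : Unit) => tens (conjMap (WA k)ᵀ ∘ₗ relabel (Equiv.prodPUnit A))
      (conjMap (WB k)ᵀ ∘ₗ relabel (Equiv.prodPUnit B)))
    fun k => isLOCC_tens ((isChannel_conjMap_transpose (hWA k)).comp (isChannel_relabel _))
      ((isChannel_conjMap_transpose (hWB k)).comp (isChannel_relabel _))
  simp only [decodeStep_kronecker _ _ (hEM _), ← Finset.smul_sum] at h2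
  exact h2

end LocalDecode

/-! ### Teleportation measurements -/

section Teleport

variable {V Y : Type} [Fintype V] [Fintype Y] [DecidableEq Y] [DecidableEq V]

/-- The effect of a teleportation measurement that corresponds to the unitary `W`. -/
def teleportEffect (e : V ≃ Y) (W : Op Y) : Op (V × Y) :=
  (Fintype.card Y : ℝ)⁻¹ • vecMulVec (fun p => W p.2 (e p.1)) (star fun p => W p.2 (e p.1))

theorem IsUnitaryBasis.isPOVM_teleportEffect [Nonempty Y] {K : Type} [Fintype K] {W : K → Op Y}
    (hW : IsUnitaryBasis W) (e : V ≃ Y) : IsPOVM fun k => teleportEffect e (W k) := by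
  refine ⟨fun k => (posSemidef_vecMulVec_self_star _).smul (by positivity), ?_⟩
  ext p q
  have hd : (Fintype.card Y : ℂ) ≠ 0 := by simp
  simp only [teleportEffect, Matrix.sum_apply, Matrix.smul_apply, vecMulVec_apply, Pi.star_apply,
    ← Finset.smul_sum, hW.sum_mul_star, one_apply, Prod.ext_iff, e.injective.eq_iff]
  by_cases h1 : p.1 = q.1 <;> by_cases h2 : p.2 = q.2 <;> simp [h1, h2, hd]

theorem decodeStep_teleportEffect (e : V ≃ Y) {W : Op Y} (hW : Wᴴ * W = 1) :
    decodeStep W (teleportEffect e W) = (Fintype.card Y : ℝ)⁻¹ • relabel e := by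
  have h : ofChoi (pairOp (teleportEffect e W)) =
      (Fintype.card Y : ℝ)⁻¹ • (conjMap (Wᵀ)ᴴ ∘ₗ relabel e) := by
    refine LinearMap.ext fun M => ?_
    ext y y'
    rw [LinearMap.smul_apply, Matrix.smul_apply, LinearMap.comp_apply, conjMap_apply, relabel_apply,
      ofChoi_apply, ← e.symm.sum_comp]
    simp only [← e.symm.sum_comp, mul_apply, Finset.sum_mul, Finset.smul_sum]
    rw [Finset.sum_comm]
    refine Finset.sum_congr rfl fun a _ => Finset.sum_congr rfl fun b _ => ?_
    simp only [pairOp, teleportEffect, submatrix_apply, transpose_apply, Matrix.smul_apply,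
      vecMulVec_apply, Pi.star_apply, conjTranspose_apply, star_star, Prod.swap, e.apply_symm_apply,
      Complex.real_smul]
    ring
  rw [decodeStep, h, LinearMap.comp_smul, ← LinearMap.comp_assoc, conjMap_comp]
  have h2 : Wᵀ * Wᵀᴴ = 1 := by
    have h3 : Wᵀᴴ = Wᴴᵀ := rfl
    rw [h3, ← transpose_mul, hW, transpose_one]
  rw [h2, conjMap_one, LinearMap.id_comp]

theorem teleportEffect_kronecker {U X : Type} [Fintype U] [Fintype X] [DecidableEq X]
    [DecidableEq U] (e : U ≃ X) (f : V ≃ Y) (W : Op X) (W' : Op Y) :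
    relabel (Equiv.prodProdProdComm U V X Y).symm (teleportEffect e W ⊗ₖ teleportEffect f W') =
      teleportEffect (Equiv.prodCongr e f) (W ⊗ₖ W') := by
  ext p q
  simp only [teleportEffect, relabel_apply, submatrix_apply, kroneckerMap_apply, Matrix.smul_apply,
    vecMulVec_apply, Pi.star_apply, Fintype.card_prod, Complex.real_smul, star_mul']
  push_cast
  rw [mul_inv]
  simp
  ring

end Teleport

/-! ### The ensemble of locally rotated states -/

section RotatedEnsemble

variable {X Y : Type} [Fintype X] [Fintype Y] [DecidableEq X] [DecidableEq Y] {n : ℕ}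

/-- The uniform ensemble of the states obtained from `ρ` by applying the unitaries `W i` to the
second system. -/
def rotatedEnsemble [NeZero n] {W : Fin n → Op Y} (hW : ∀ i, (W i)ᴴ * W i = 1) {ρ : Op (X × Y)}
    (hρ : IsState ρ) : Ensemble (X × Y) n where
  prob _ := (n : ℝ)⁻¹
  state i := ampL X (conjMap (W i)) ρ
  prob_nonneg _ := by positivity
  prob_sum := by simp [NeZero.ne]
  state_isState i := hρ.apply ((isChannel_conjMap (hW i)).ampL X)

variable [Nonempty Y] [NeZero n] {W : Fin n → Op Y} (hW : IsUnitaryBasis W) {ρ : Op (X × Y)}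
  (hρ : IsState ρ)

theorem inv_mul_card (hW : IsUnitaryBasis W) : (n : ℝ)⁻¹ * Fintype.card Y = (Fintype.card Y : ℝ)⁻¹ := by
  have h : n = Fintype.card Y ^ 2 := by simpa using hW.card
  have hd : (Fintype.card Y : ℝ) ≠ 0 := by simp
  rw [h]
  push_cast
  field_simp

theorem psucc_rotatedEnsemble_le {s : ℝ} (hs : 0 ≤ s)
    (h : ∀ α : QMap X Y, IsChannel α → pairing ρ α ≤ s) :
    (rotatedEnsemble hW.unitary hρ).psucc ≤ (Fintype.card Y : ℝ)⁻¹ * s := by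
  refine Ensemble.psucc_le _ (by positivity) fun M hM => ?_
  have h1 := h _ (isChannel_decode hW.unitary hM)
  rw [← LinearMap.comp_id (decode W M), pairing_decode_comp] at h1
  have hd : (0 : ℝ) < Fintype.card Y := by simp [Fintype.card_pos]
  rw [inv_mul_le_iff₀ hd] at h1
  simp only [rotatedEnsemble]
  rw [← Finset.mul_sum, ← inv_mul_card hW, mul_assoc]
  exact mul_le_mul_of_nonneg_left h1 (by positivity)

end RotatedEnsemble

section Game

variable {A₀ B₀ A₁ B₁ S₀ T₀ S₁ T₁ : Type}
  [Fintype A₀] [Fintype B₀] [Fintype A₁] [Fintype B₁]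
  [Fintype S₀] [Fintype T₀] [Fintype S₁] [Fintype T₁]
  [DecidableEq A₁] [DecidableEq B₁]
  [DecidableEq S₀] [DecidableEq T₀] [DecidableEq S₁] [DecidableEq T₁] [Nonempty S₁] [Nonempty T₁]
  {n : ℕ} [NeZero n]
  {K L : Type} [Fintype K] [Fintype L] {WA : K → Op S₁} {WB : L → Op T₁} (e : Fin n ≃ K × L)
  (hWA : IsUnitaryBasis WA) (hWB : IsUnitaryBasis WB)
  {ρ : Op ((S₀ × T₀) × (S₁ × T₁))} (hρ : IsState ρ) {Φ : QMap (A₀ × B₀) (A₁ × B₁)}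

theorem LOCCStrategy.value_rotatedEnsemble {W : Fin n → Op (S₁ × T₁)}
    (hW : ∀ i, (W i)ᴴ * W i = 1)
    (σ : LOCCStrategy A₀ B₀ A₁ B₁ S₀ T₀ S₁ T₁ n) :
    σ.value Φ (rotatedEnsemble hW hρ) = (n : ℝ)⁻¹ * ∑ i, pairing ρ (decodeStep (W i)
      (relabel (Equiv.prodProdProdComm _ _ S₁ T₁).symm (σ.meas i)) ∘ₗ
        (withAncilla σ.UA σ.UB Φ ∘ₗ σ.pre)) := by
  rw [value_eq, Finset.mul_sum]
  refine Finset.sum_congr rfl fun i _ => ?_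
  change (n : ℝ)⁻¹ * _ = _
  rw [pairing_decodeStep_comp, ← trace_relabel (Equiv.prodProdProdComm _ _ S₁ T₁)]
  have h := submatrix_mul_equiv (ampR (withAncilla σ.UA σ.UB Φ ∘ₗ σ.pre) (S₁ × T₁)
    (ampL (S₀ × T₀) (conjMap (W i)) ρ))
    (relabel (Equiv.prodProdProdComm _ _ S₁ T₁).symm (σ.meas i))
    (Equiv.prodProdProdComm _ _ S₁ T₁).symm (Equiv.prodProdProdComm _ _ S₁ T₁).symm
    (Equiv.prodProdProdComm _ _ S₁ T₁).symm
  rw [relabel_apply, ← h]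
  rfl

theorem psuccLOCC_rotatedEnsemble_le {s : ℝ} (hs : 0 ≤ s)
    (h : ∀ Λ : LOCCSuperchannel A₀ B₀ A₁ B₁ S₀ T₀ S₁ T₁, pairing ρ (Λ.apply Φ) ≤ s) :
    psuccLOCC Φ (rotatedEnsemble (hWA.kronecker hWB e).unitary hρ) ≤
      (Fintype.card (S₁ × T₁) : ℝ)⁻¹ * s := by
  refine Real.iSup_le (fun σ => ?_) (by positivity)
  rw [σ.value_rotatedEnsemble hρ]
  have h1 := h ⟨σ.UA, σ.UB, σ.pre, _, σ.pre_locc,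
    isLOCC_decode (fun i => hWA.unitary (e i).1) (fun i => hWB.unitary (e i).2) σ.meas_locc⟩
  rw [LOCCSuperchannel.apply, pairing_decode_comp] at h1
  simp only [← pairing_decodeStep_comp] at h1
  have hd : (0 : ℝ) < Fintype.card (S₁ × T₁) := by simp [Fintype.card_pos]
  rw [inv_mul_le_iff₀ hd] at h1
  rw [← inv_mul_card (hWA.kronecker hWB e), mul_assoc]
  exact mul_le_mul_of_nonneg_left h1 (by positivity)

theorem le_psuccLOCC_rotatedEnsemble {Φ : QMap (S₀ × T₀) (S₁ × T₁)} (hΦ : IsChannel Φ) :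
    (Fintype.card (S₁ × T₁) : ℝ)⁻¹ * pairing ρ Φ ≤
      psuccLOCC Φ (rotatedEnsemble (hWA.kronecker hWB e).unitary hρ) := by
  let σ : LOCCStrategy S₀ T₀ S₁ T₁ S₀ T₀ S₁ T₁ n := {
    UA := Unit
    UB := Unit
    pre := relabel (Equiv.prodCongr (Equiv.punitProd S₀).symm (Equiv.punitProd T₀).symm)
    meas := fun i => teleportEffect (Equiv.punitProd S₁) (WA (e i).1) ⊗ₖ
      teleportEffect (Equiv.punitProd T₁) (WB (e i).2)
    pre_locc := isLOCC_relabel _ _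
    meas_locc := isLOCCMeasurement_kronecker (hWA.isPOVM_teleportEffect _)
      (hWB.isPOVM_teleportEffect _) e }
  refine le_trans (le_of_eq ?_) (σ.value_le_psuccLOCC hΦ _)
  rw [σ.value_rotatedEnsemble hρ]
  have h : ∀ i, pairing ρ (decodeStep (WA (e i).1 ⊗ₖ WB (e i).2)
      (relabel (Equiv.prodProdProdComm _ _ S₁ T₁).symm (σ.meas i)) ∘ₗ
        (withAncilla σ.UA σ.UB Φ ∘ₗ σ.pre)) =
      (Fintype.card (S₁ × T₁) : ℝ)⁻¹ * pairing ρ Φ := fun i => by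
    change pairing ρ (decodeStep (WA (e i).1 ⊗ₖ WB (e i).2) (relabel _
      (teleportEffect (Equiv.punitProd S₁) (WA (e i).1) ⊗ₖ
        teleportEffect (Equiv.punitProd T₁) (WB (e i).2))) ∘ₗ _) = _
    rw [teleportEffect_kronecker, decodeStep_teleportEffect _ ((hWA.kronecker hWB e).unitary i),
      ← pairing_smul_right]
    rfl
  simp only [h]
  have hn : (n : ℝ) ≠ 0 := NeZero.ne _
  simp [hn]

end Game

theorem exists_fin_unitaryBasis (X Y : Type) [Fintype X] [DecidableEq X] [Nonempty X]
    [Fintype Y] [DecidableEq Y] [Nonempty Y] :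
    ∃ (n : ℕ) (_ : NeZero n) (K L : Type) (_ : Fintype K) (_ : Fintype L) (_ : Fin n ≃ K × L)
      (V : K → Op X) (W : L → Op Y), IsUnitaryBasis V ∧ IsUnitaryBasis W := by
  obtain ⟨K, _, V, hV⟩ := exists_isUnitaryBasis X
  obtain ⟨L, _, W, hW⟩ := exists_isUnitaryBasis Y
  refine ⟨Fintype.card (K × L), ⟨?_⟩, K, L, inferInstance, inferInstance,
    (Fintype.equivFin _).symm, V, W, hV, hW⟩
  rw [Fintype.card_prod, hV.card, hW.card]
  simp

section Converse

variable {A₀ B₀ A₁ B₁ S₀ T₀ S₁ T₁ : Type}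
  [Fintype A₀] [Fintype B₀] [Fintype A₁] [Fintype B₁] [DecidableEq A₀] [DecidableEq B₀]
  [Fintype S₀] [Fintype T₀] [Fintype S₁] [Fintype T₁]
  [Nonempty A₀] [Nonempty B₀] [Nonempty S₁] [Nonempty T₁]
  {ρ : Op ((S₀ × T₀) × (S₁ × T₁))} {Φ : QMap (A₀ × B₀) (A₁ × B₁)}

theorem norm2LOCC_nonneg (hρ : IsState ρ) (hΦ : IsChannel Φ) :
    0 ≤ norm2LOCC (tensorChoi ρ (choi Φ)) :=
  (pairing_nonneg hρ.1 ((Classical.arbitrary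
    (LOCCSuperchannel A₀ B₀ A₁ B₁ S₀ T₀ S₁ T₁)).isCP_apply hΦ.1)).trans (le_norm2LOCC hρ hΦ _)

theorem lt_pairing_of_forall {Ψ : QMap (S₀ × T₀) (S₁ × T₁)} (hρ : IsState ρ)
    {s c : ℝ} (hs : 0 ≤ s) (hc : s < c)
    (h : ∀ (Λ : LOCCSuperchannel A₀ B₀ A₁ B₁ S₀ T₀ S₁ T₁) (α : QMap (S₀ × T₀) (S₁ × T₁)),
      IsChannel α → pairing ρ (Λ.apply Φ) + c * pairing ρ α ≤ pairing ρ Ψ) :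
    norm2LOCC (tensorChoi ρ (choi Φ)) + s * dualDiamondNorm ρ < pairing ρ Ψ := by
  classical
  have hc0 : 0 < c := hs.trans_lt hc
  have h1 : ∀ α : QMap (S₀ × T₀) (S₁ × T₁), IsChannel α →
      pairing ρ α ≤ (pairing ρ Ψ - norm2LOCC (tensorChoi ρ (choi Φ))) / c := by
    intro α hα
    rw [le_div_iff₀ hc0]
    have h2 : norm2LOCC (tensorChoi ρ (choi Φ)) ≤ pairing ρ Ψ - c * pairing ρ α :=
      norm2LOCC_le fun Λ => by linarith [h Λ α hα]
    linarith
  have hα := isChannel_replaceMap (X := S₀ × T₀) (isState_mixed (X := S₁ × T₁))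
  have h2 := dualDiamondNorm_le hρ ((pairing_nonneg hρ.1 hα.1).trans (h1 _ hα)) h1
  rw [le_div_iff₀ hc0] at h2
  nlinarith [dualDiamondNorm_pos hρ]

end Converse

end

end QLOCC

theorem theorem7 {A₀ B₀ A₁ B₁ A₀' B₀' A₁' B₁' : Type}
    [Fintype A₀] [DecidableEq A₀] [Nonempty A₀] [Fintype B₀] [DecidableEq B₀] [Nonempty B₀]
    [Fintype A₁] [DecidableEq A₁] [Nonempty A₁] [Fintype B₁] [DecidableEq B₁] [Nonempty B₁]
    [Fintype A₀'] [DecidableEq A₀'] [Nonempty A₀'] [Fintype B₀'] [DecidableEq B₀'] [Nonempty B₀']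
    [Fintype A₁'] [DecidableEq A₁'] [Nonempty A₁'] [Fintype B₁'] [DecidableEq B₁'] [Nonempty B₁']
    (Φ₁ : QMap (A₀ × B₀) (A₁ × B₁)) (hΦ₁ : IsChannel Φ₁)
    (Φ₂ : QMap (A₀' × B₀') (A₁' × B₁')) (hΦ₂ : IsChannel Φ₂)
    (ε : ℝ) (hε : 0 ≤ ε) :
    List.TFAE [
      -- (i)
      deltaLOCC Φ₁ Φ₂ ≤ ε,
      -- (ii), arbitrary reference spaces
      ∀ (S₀ T₀ S₁ T₁ : Type) [Fintype S₀] [Nonempty S₀] [Fintype T₀] [Nonempty T₀]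
        [Fintype S₁] [Nonempty S₁] [Fintype T₁] [Nonempty T₁]
        (ρ : Op ((S₀ × T₀) × (S₁ × T₁))), IsState ρ →
        norm2LOCC (tensorChoi ρ (choi Φ₂)) ≤
          norm2LOCC (tensorChoi ρ (choi Φ₁)) + ε / 2 * dualDiamondNorm ρ,
      -- (ii), reference spaces isomorphic to the target systems
      ∀ ρ : Op ((A₀' × B₀') × (A₁' × B₁')), IsState ρ →
        norm2LOCC (tensorChoi ρ (choi Φ₂)) ≤
          norm2LOCC (tensorChoi ρ (choi Φ₁)) + ε / 2 * dualDiamondNorm ρ,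
      -- (iii), arbitrary reference spaces
      ∀ (S₀ T₀ S₁ T₁ : Type) [Fintype S₀] [DecidableEq S₀] [Nonempty S₀]
        [Fintype T₀] [DecidableEq T₀] [Nonempty T₀] [Fintype S₁] [DecidableEq S₁] [Nonempty S₁]
        [Fintype T₁] [DecidableEq T₁] [Nonempty T₁]
        (n : ℕ) (𝓔 : Ensemble ((S₀ × T₀) × (S₁ × T₁)) n),
        psuccLOCC Φ₂ 𝓔 ≤ psuccLOCC Φ₁ 𝓔 + ε / 2 * 𝓔.psucc,
      -- (iii), reference spaces isomorphic to the target systems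
      ∀ (n : ℕ) (𝓔 : Ensemble ((A₀' × B₀') × (A₁' × B₁')) n),
        psuccLOCC Φ₂ 𝓔 ≤ psuccLOCC Φ₁ 𝓔 + ε / 2 * 𝓔.psucc] := by
  have hnorm : deltaLOCC Φ₁ Φ₂ ≤ ε → ∀ (S₀ T₀ S₁ T₁ : Type) [Fintype S₀] [Nonempty S₀]
      [Fintype T₀] [Nonempty T₀] [Fintype S₁] [Nonempty S₁] [Fintype T₁] [Nonempty T₁]
      (ρ : Op ((S₀ × T₀) × (S₁ × T₁))), IsState ρ →
      norm2LOCC (tensorChoi ρ (choi Φ₂)) ≤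
        norm2LOCC (tensorChoi ρ (choi Φ₁)) + ε / 2 * dualDiamondNorm ρ := by
    intro h S₀ T₀ S₁ T₁ _ _ _ _ _ _ _ _ ρ hρ
    rw [deltaLOCC_le_iff hΦ₁ hΦ₂ hε] at h
    exact le_add_mul_of_forall_lt fun c hc =>
      norm2LOCC_le_of_isDominated hρ hΦ₁ (by linarith) (h c hc)
  have hgame : deltaLOCC Φ₁ Φ₂ ≤ ε → ∀ (S₀ T₀ S₁ T₁ : Type) [Fintype S₀] [DecidableEq S₀]
      [Nonempty S₀] [Fintype T₀] [DecidableEq T₀] [Nonempty T₀] [Fintype S₁] [DecidableEq S₁]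
      [Nonempty S₁] [Fintype T₁] [DecidableEq T₁] [Nonempty T₁]
      (n : ℕ) (𝓔 : Ensemble ((S₀ × T₀) × (S₁ × T₁)) n),
      psuccLOCC Φ₂ 𝓔 ≤ psuccLOCC Φ₁ 𝓔 + ε / 2 * 𝓔.psucc := by
    intro h S₀ T₀ S₁ T₁ _ _ _ _ _ _ _ _ _ _ _ _ n 𝓔
    rw [deltaLOCC_le_iff hΦ₁ hΦ₂ hε] at h
    exact le_add_mul_of_forall_lt fun c hc =>
      psuccLOCC_le_of_isDominated hΦ₁ (by linarith) (h c hc) 𝓔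
  have hdelta : (∀ ρ : Op ((A₀' × B₀') × (A₁' × B₁')), IsState ρ →
      pairing ρ Φ₂ ≤ norm2LOCC (tensorChoi ρ (choi Φ₁)) + ε / 2 * dualDiamondNorm ρ) →
      deltaLOCC Φ₁ Φ₂ ≤ ε := by
    intro h
    rw [deltaLOCC_le_iff hΦ₁ hΦ₂ hε]
    intro c hc
    by_contra hnot
    obtain ⟨ρ, hρ, hle⟩ := exists_state_of_not_isDominated hΦ₁ hΦ₂ hnot
    exact absurd (h ρ hρ) (not_le.mpr (lt_pairing_of_forall hρ (by positivity) hc hle))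
  tfae_have 1 → 2 := hnorm
  tfae_have 2 → 3 := fun h => h A₀' B₀' A₁' B₁'
  tfae_have 3 → 1 := fun h => hdelta fun ρ hρ =>
    (le_norm2LOCC hρ hΦ₂ (LOCCSuperchannel.one A₀' B₀' A₁' B₁')).trans (h ρ hρ)
  tfae_have 1 → 4 := hgame
  tfae_have 4 → 5 := fun h => h A₀' B₀' A₁' B₁'
  tfae_have 5 → 1 := fun h => hdelta fun ρ hρ => by
    obtain ⟨n, _, K, L, _, _, e, V, W, hV, hW⟩ := exists_fin_unitaryBasis A₁' B₁'
    have hd : (0 : ℝ) < (Fintype.card (A₁' × B₁') : ℝ)⁻¹ := by simp [Fintype.card_pos]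
    have h1 := (le_psuccLOCC_rotatedEnsemble e hV hW hρ hΦ₂).trans (h n _)
    have h2 := psuccLOCC_rotatedEnsemble_le e hV hW hρ
      (norm2LOCC_nonneg hρ hΦ₁) fun Λ => le_norm2LOCC hρ hΦ₁ Λ
    have h3 := psucc_rotatedEnsemble_le (hV.kronecker hW e) hρ (dualDiamondNorm_pos hρ).le
      fun α hα => le_dualDiamondNorm hρ hα
    refine le_of_mul_le_mul_left ?_ hd
    linarith [mul_le_mul_of_nonneg_left h3 (by positivity : 0 ≤ ε / 2)]
  tfae_finish
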